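/- Let $P_{\rm target}$ be a probability distribution on $\mathbb R^n$ with finite second moments, mean $\mu$ and covariance $C$. Let $u_1,\dots,u_n$ be an orthonormal basis of eigenvectors of $C$ with eigenvalues $\lambda_1\ge\dots\ge\lambda_n\ge 0$, and let $K\ge 0$. Let $C_K=\sum_{i\le \min(K,n)}\lambda_iu_iu_i^T$ and, for $\sigma>0$, $L^*_\sigma=\sum_{i\le \min(K,n)}\frac{\lambda_i}{\lambda_i+\sigma^2}u_iu_i^T$. At noise level $\sigma$ the observation is $y=x+\sigma z$, where $x\sim P_{\rm target}$ and $z\sim N(0,I)$ are independent. A denoiser $S$ has error $E\|S(y)-x\|^2$. A linear denoiser with bottleneck $K$ is a map $S(y)=ABy$ with $A\in\mathbb R^{n\times K}$ and $B\in\mathbb R^{K\times n}$; with a bias it is $S(y)=ABy+b$ with $b\in\mathbb R^n$. A trained denoiser is a family $S(\cdot,\sigma)$, $\sigma>0$, whose member at each $\sigma$ minimizes the error over the architecture. The diffusion model with denoiser $S$ samples as follows. For noise levels $\sigma_0>\sigma_1>\dots>\sigma_N=0$, start with $y_0\sim N(0,\sigma_0^2I)$ and set $$y_{j+1}=S(y_j,\sigma_j)+\frac{\sqrt{\sigma_{j+1}^2-\tau_j^2}}{\sigma_j}\bigl(y_j-S(y_j,\sigma_j)\bigr)+\tau_jz_j,\qquad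 \tau_j=\eta\,\sigma_{j+1}\sqrt{1-\sigma_{j+1}^2/\sigma_j^2},$$ where the $z_j\sim N(0,I)$ are independent of each other and of $y_0$, and $\eta\in[0,1]$ is fixed ($\eta=0$ is the deterministic DDIM sampler and $\eta=1$ is ancestral DDPM sampling). The model generates a distribution $Q$ if the law of $y_N$ converges weakly to $Q$ along every sequence of noise schedules with $\sigma_0\to\infty$ and $\max_j(\sigma_j-\sigma_{j+1})\to0$; then $P_{\rm generated}=Q$. Then: 1. $C_K$ is a best approximation of $C$ in Frobenius norm among the matrices of rank at most $K$. 2. If $\mu=0$, then for every $\sigma>0$ the linear denoisers with bottleneck $K$ of minimal error are exactly the maps $y\mapsto L^*_\sigma y$, where $L^*_\sigma$ may be formed with any orthonormal eigenbasis of $C$ ordered by decreasing eigenvalues. For arbitrary $\mu$, the minimizers among the linear denoisers with bottleneck $K$ and bias are exactly the maps $y\mapsto\mu+L^*_\sigma(y-\mu)$, with the same freedom. 3. Suppose that $K=0$, or $K\ge n$, or $\lambda_K>\lambda_{K+1}$, or $\lambda_{K+1}=0$. Then the minimizer is unique. Every trained denoiser (linear if $\mu=0$; with bias for arbitrary $\mu$)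 is $S(y,\sigma)=\mu+L^*_\sigma(y-\mu)$ for all $\sigma>0$, and for every $\eta\in[0,1]$ $$P_{\rm generated}=N(\mu,C_K).$$ 4. Without the assumption of part 3, the denoiser $S(y,\sigma)=\mu+L^*_\sigma(y-\mu)$ formed with the same eigenbasis $u_1,\dots,u_n$ at all noise levels still has $P_{\rm generated}=N(\mu,C_K)$ for every $\eta\in[0,1]$. -/

import Mathlib

open MeasureTheory ProbabilityTheory Filter Topology
open scoped BoundedContinuousFunction

noncomputable section

namespace BottleneckDiffusion

/-- Euclidean space `ℝⁿ`. -/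
abbrev Vec (n : ℕ) : Type := EuclideanSpace ℝ (Fin n)

/-- The linear map `y ↦ M y` on `ℝⁿ` given by a matrix `M`. -/
def act {n : ℕ} (M : Matrix (Fin n) (Fin n) ℝ) (y : Vec n) : Vec n :=
  WithLp.toLp 2 (M.mulVec y.ofLp)

/-! ### Denoising: error, architectures, training -/

/-- Mean squared error `E ‖S(x + σ z) - x‖²` of a denoiser `S` at noise level `σ`, where the clean
signal `x` has law `P` and the noise `z` is standard Gaussian and independent of `x`. -/
def mse {n : ℕ} (P : Measure (Vec n)) (σ : ℝ) (S : Vec n → Vec n) : ℝ :=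
  ∫ p : Vec n × Vec n, ‖S (p.1 + σ • p.2) - p.1‖ ^ 2 ∂(P.prod (stdGaussian (Vec n)))

/-- Linear denoisers with a bottleneck of size `K`: the maps `y ↦ A B y`. -/
def LinearBottleneck (n K : ℕ) : Set (Vec n → Vec n) :=
  {S | ∃ (A : Matrix (Fin n) (Fin K) ℝ) (B : Matrix (Fin K) (Fin n) ℝ),
    ∀ y, S y = act (A * B) y}

/-- The same architecture with an output bias: the maps `y ↦ A B y + b`. -/
def AffineBottleneck (n K : ℕ) : Set (Vec n → Vec n) :=
  {S | ∃ (A : Matrix (Fin n) (Fin K) ℝ) (B : Matrix (Fin K) (Fin n) ℝ) (b : Vec n),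
    ∀ y, S y = act (A * B) y + b}

/-- `S` minimizes the mean squared error at noise level `σ` over the architecture `F`. -/
def IsMSEOptimal {n : ℕ} (P : Measure (Vec n)) (F : Set (Vec n → Vec n)) (σ : ℝ)
    (S : Vec n → Vec n) : Prop :=
  S ∈ F ∧ ∀ S' ∈ F, mse P σ S ≤ mse P σ S'

/-- A trained denoiser `S(y, σ)`: it is optimal within the architecture at every noise level. -/
def IsTrained {n : ℕ} (P : Measure (Vec n)) (F : Set (Vec n → Vec n))
    (S : ℝ → Vec n → Vec n) : Prop :=
  ∀ σ : ℝ, 0 < σ → IsMSEOptimal P F σ (S σ)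

/-! ### Covariance and its spectral truncation -/

/-- The mean of `P`. -/
def meanVec {n : ℕ} (P : Measure (Vec n)) : Vec n := ∫ x, x ∂P

/-- The covariance matrix of `P`. -/
def covMat {n : ℕ} (P : Measure (Vec n)) : Matrix (Fin n) (Fin n) ℝ :=
  Matrix.of fun i j => covariance (fun x : Vec n => x i) (fun x : Vec n => x j) P

/-- `u` is an orthonormal basis of eigenvectors of `C`, with eigenvalues `lam` listed in
decreasing order. -/
def IsSortedEigenbasis {n : ℕ} (C : Matrix (Fin n) (Fin n) ℝ) (lam : Fin n → ℝ)
    (u : OrthonormalBasis (Fin n) ℝ (Vec n)) : Prop :=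
  Antitone lam ∧ ∀ i, act C (u i) = lam i • u i

/-- The rank-`K` eigen-truncation `∑_{i ≤ K} λ_i u_i u_iᵀ`. -/
def eigenTrunc {n : ℕ} (lam : Fin n → ℝ) (u : OrthonormalBasis (Fin n) ℝ (Vec n)) (K : ℕ) :
    Matrix (Fin n) (Fin n) ℝ :=
  ∑ i : Fin n with i.val < K, lam i • Matrix.vecMulVec (u i).ofLp (u i).ofLp

/-- The matrix `L* = ∑_{i ≤ K} λ_i / (λ_i + σ²) u_i u_iᵀ`. -/
def optimalMap {n : ℕ} (lam : Fin n → ℝ) (u : OrthonormalBasis (Fin n) ℝ (Vec n)) (K : ℕ)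
    (σ : ℝ) : Matrix (Fin n) (Fin n) ℝ :=
  ∑ i : Fin n with i.val < K, (lam i / (lam i + σ ^ 2)) • Matrix.vecMulVec (u i).ofLp (u i).ofLp

/-- The `K` leading terms are unambiguous: every eigenvalue past the `K`-th is either strictly
smaller than the first `K` ones or zero. -/
def HasSpectralGap {n : ℕ} (lam : Fin n → ℝ) (K : ℕ) : Prop :=
  ∀ i j : Fin n, i.val < K → K ≤ j.val → lam j < lam i ∨ lam j = 0

/-- `D` is a best approximation of `C` in Frobenius norm among matrices of rank at most `K`. -/
def IsBestRankApprox {n : ℕ} (K : ℕ) (C D : Matrix (Fin n) (Fin n) ℝ) : Prop :=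
  D.rank ≤ K ∧ ∀ X : Matrix (Fin n) (Fin n) ℝ, X.rank ≤ K →
    ∑ i, ∑ j, (C i j - D i j) ^ 2 ≤ ∑ i, ∑ j, (C i j - X i j) ^ 2

/-! ### Sampling from a diffusion model -/

/-- A finite sequence of noise levels `σ_0 > σ_1 > ⋯ > σ_N = 0`. -/
structure NoiseSchedule where
  steps : ℕ
  level : ℕ → ℝ
  decreasing : ∀ j < steps, level (j + 1) < level j
  last : level steps = 0

/-- Standard deviation of the noise injected when passing from noise level `a` to `b < a`;
`η = 0` is deterministic sampling (DDIM), `η = 1` is ancestral sampling (DDPM). -/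
def injected (η a b : ℝ) : ℝ := η * b * √(1 - b ^ 2 / a ^ 2)

/-- One sampling step from noise level `a` to noise level `b`: the predicted clean signal
`S(y, a)`, plus the predicted noise direction `(y - S(y, a)) / a` and fresh noise `z`, scaled so
that the total noise variance is `b ^ 2`. -/
def step {n : ℕ} (S : ℝ → Vec n → Vec n) (η a b : ℝ) (y z : Vec n) : Vec n :=
  S a y + (√(b ^ 2 - injected η a b ^ 2) / a) • (y - S a y) + injected η a b • z

/-- The law of the sampler after `j` steps. It starts from pure noise `N(0, σ_0² I)`, and each step
uses fresh standard Gaussian noise. -/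
def samplerLaw {n : ℕ} (S : ℝ → Vec n → Vec n) (η : ℝ) (s : ℕ → ℝ) : ℕ → Measure (Vec n)
  | 0 => (stdGaussian (Vec n)).map fun z => s 0 • z
  | j + 1 => ((samplerLaw S η s j).prod (stdGaussian (Vec n))).map
      fun p => step S η (s j) (s (j + 1)) p.1 p.2

/-- `Q` is the distribution generated by the diffusion model with denoiser `S`: the laws of the
output of the sampler converge weakly to `Q` whenever the initial noise level tends to infinity and
the largest step between noise levels tends to zero. -/
def Generates {n : ℕ} (S : ℝ → Vec n → Vec n) (η : ℝ) (Q : Measure (Vec n)) : Prop :=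
  ∀ s : ℕ → NoiseSchedule,
    Tendsto (fun m => (s m).level 0) atTop atTop →
    (∀ δ : ℝ, 0 < δ → ∀ᶠ m in atTop,
      ∀ j < (s m).steps, (s m).level j - (s m).level (j + 1) ≤ δ) →
    ∀ f : Vec n →ᵇ ℝ,
      Tendsto (fun m => ∫ x, f x ∂(samplerLaw S η (s m).level (s m).steps)) atTop
        (𝓝 (∫ x, f x ∂Q))

end BottleneckDiffusion

end

open BottleneckDiffusion

/-! Training is a low-rank approximation problem. The error of `y ↦ L y + b` is `‖L μ + b - μ‖²`
plus a quadratic function of `L` (`mse_affine`), so the bias can remove the first term. Completing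
the square with `G = C + σ² I` turns the second into the squared Frobenius norm of `L G^(1/2) - C
G^(-1/2)` plus a constant (`linearError_eq`). Multiplication by the invertible `G^(1/2)` preserves
rank, and the eigenvalues `λ / √(λ + σ²)` of `C G^(-1/2)` increase strictly with `λ`, so its sorted
eigenbases are those of `C`. The optimal `L` are therefore the Eckart-Young truncations of `C
G^(-1/2)`, multiplied by `G^(-1/2)`.

Describing all minimizers needs the equality case of Eckart-Young. For `T` with range `V`, the error
is at least `∑ s_i² (1 - w_i)`, where `w_i = ‖P_V u_i‖²` lies in `[0, 1]` and `∑ w_i = dim V ≤ K`; a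
weight of mass `K` does best on the `K` largest `s_i²`. If the first discarded eigenvalue `t` is
positive, equality forces `T = P_V D` and `dim V = K`, with `V` containing the eigenvectors above
`t` and orthogonal to those below. Such a `V` is spanned by the leading vectors of a sorted
eigenbasis (`exists_basis_of_starProjection`).

For sampling, a denoiser diagonal in one fixed basis decouples the sampler into scalar Gaussian
recursions. With `l = λ_i` for retained coordinates and `l = 0` for the others, the variance follows
`l + σ_j²`: its deviation starts at `-l`, is contracted at each step, and receives a local error of
second order in the step size (`variance_step_eq`). The contraction removes the initial deviation as
`σ_0 → ∞`, the local errors telescope to a multiple of the mesh (`abs_sampleVariance_sub_le`), and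
the same contraction brings the mean to `μ`. All the laws are affine images of one standard
Gaussian, so convergence of coefficients gives weak convergence. -/

namespace BottleneckDiffusion

/-! ### Operators diagonal in an orthonormal basis and the Eckart-Young bound -/

section SpectralTruncation

variable {E : Type*} [NormedAddCommGroup E] [InnerProductSpace ℝ E] {n : ℕ}

/-- The self-adjoint operator with eigenvectors `u i` and eigenvalues `s i`. -/
noncomputable def diagOp (u : OrthonormalBasis (Fin n) ℝ E) (s : Fin n → ℝ) : E →ₗ[ℝ] E :=
  ∑ i, s i • (InnerProductSpace.rankOne ℝ (u i) (u i) : E →L[ℝ] E).toLinearMap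

/-- The sequence `s` with all entries from position `K` on replaced by zero. -/
def truncSeq (s : Fin n → ℝ) (K : ℕ) (i : Fin n) : ℝ := if i.val < K then s i else 0

theorem diagOp_apply (u : OrthonormalBasis (Fin n) ℝ E) (s : Fin n → ℝ) (x : E) :
    diagOp u s x = ∑ i, (s i * inner ℝ (u i) x) • u i := by
  simp [diagOp, LinearMap.sum_apply, smul_smul]

@[simp]
theorem diagOp_basis (u : OrthonormalBasis (Fin n) ℝ E) (s : Fin n → ℝ) (i : Fin n) :
    diagOp u s (u i) = s i • u i := by
  rw [diagOp_apply, Finset.sum_eq_single i]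
  · simp
  · intro j _ hj
    simp [u.inner_eq_zero hj]
  · simp

theorem inner_diagOp (u : OrthonormalBasis (Fin n) ℝ E) (s : Fin n → ℝ) (i : Fin n) (x : E) :
    inner ℝ (u i) (diagOp u s x) = s i * inner ℝ (u i) x := by
  rw [diagOp_apply, u.orthonormal.inner_right_fintype]

theorem inner_diagOp_self (u : OrthonormalBasis (Fin n) ℝ E) (s : Fin n → ℝ) (x : E) :
    inner ℝ x (diagOp u s x) = ∑ i, s i * inner ℝ (u i) x ^ 2 := by
  rw [diagOp_apply, inner_sum]
  refine Finset.sum_congr rfl fun i _ => ?_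
  rw [real_inner_smul_right, real_inner_comm x (u i)]
  ring

theorem diagOp_isSymmetric (u : OrthonormalBasis (Fin n) ℝ E) (s : Fin n → ℝ) :
    (diagOp u s).IsSymmetric := by
  intro x y
  rw [diagOp_apply, diagOp_apply, sum_inner, inner_sum]
  refine Finset.sum_congr rfl fun i _ => ?_
  rw [real_inner_smul_left, real_inner_smul_right, real_inner_comm x (u i)]
  ring

/-- Two diagonal operators agree iff overlapping basis vectors carry equal eigenvalues. -/
theorem diagOp_eq_iff (u v : OrthonormalBasis (Fin n) ℝ E) (s s' : Fin n → ℝ) :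
    diagOp u s = diagOp v s' ↔ ∀ i j, inner ℝ (u j) (v i) ≠ 0 → s j = s' i := by
  constructor
  · intro h i j hij
    have h1 := inner_diagOp u s j (v i)
    rw [h, diagOp_basis, real_inner_smul_right] at h1
    exact (mul_right_cancel₀ hij h1).symm
  · intro h
    refine v.toBasis.ext fun i => ?_
    rw [OrthonormalBasis.coe_toBasis, diagOp_basis, diagOp_apply]
    conv_rhs => rw [← u.sum_repr' (v i), Finset.smul_sum]
    refine Finset.sum_congr rfl fun j _ => ?_
    rw [smul_smul]
    by_cases hij : inner ℝ (u j) (v i) = 0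
    · simp [hij]
    · rw [h i j hij]

/-- The Hilbert-Schmidt norm does not depend on the orthonormal basis. -/
theorem sum_norm_sq_apply_basis_eq [FiniteDimensional ℝ E] (u v : OrthonormalBasis (Fin n) ℝ E)
    (T : E →ₗ[ℝ] E) :
    ∑ i, ‖T (u i)‖ ^ 2 = ∑ i, ‖T (v i)‖ ^ 2 := by
  have key (w : OrthonormalBasis (Fin n) ℝ E) :
      ∑ i, ‖T (w i)‖ ^ 2 = LinearMap.trace ℝ E (LinearMap.adjoint T ∘ₗ T) := by
    rw [LinearMap.trace_eq_sum_inner _ w]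
    refine Finset.sum_congr rfl fun i _ => ?_
    rw [LinearMap.comp_apply, LinearMap.adjoint_inner_right, real_inner_self_eq_norm_sq]
  rw [key u, key v]

/-- The trace of a projection is its rank. This fixes the total mass of the weights `‖P_V u_i‖²` in
the Eckart-Young argument. -/
theorem sum_norm_sq_starProjection [FiniteDimensional ℝ E] (u : OrthonormalBasis (Fin n) ℝ E)
    (V : Submodule ℝ E) :
    ∑ i, ‖V.starProjection (u i)‖ ^ 2 = Module.finrank ℝ V := by
  have hproj : LinearMap.IsProj V (V.starProjection : E →L[ℝ] E).toLinearMap :=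
    ⟨fun x => V.starProjection_apply_mem x, fun x hx => V.starProjection_eq_self_iff.2 hx⟩
  rw [← hproj.trace, LinearMap.trace_eq_sum_inner _ u]
  refine Finset.sum_congr rfl fun i _ => ?_
  rw [ContinuousLinearMap.coe_coe, real_inner_comm]
  simpa using (V.re_inner_starProjection_eq_normSq (u i)).symm

/-- The squares `⟨u_j, v_i⟩²` form a doubly stochastic matrix supported on pairs with `s j = s' i`,
so it transports one sum to the other. -/
theorem sum_comp_eq_of_diagOp_eq {u v : OrthonormalBasis (Fin n) ℝ E} {s s' : Fin n → ℝ}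
    (h : diagOp u s = diagOp v s') (f : ℝ → ℝ) : ∑ j, f (s j) = ∑ i, f (s' i) := by
  have h' := (diagOp_eq_iff u v s s').1 h
  calc ∑ j, f (s j) = ∑ j, ∑ i, f (s j) * inner ℝ (u j) (v i) ^ 2 := by
        refine Finset.sum_congr rfl fun j _ => ?_
        rw [← Finset.mul_sum, v.sum_sq_inner_left]; simp
    _ = ∑ j, ∑ i, f (s' i) * inner ℝ (u j) (v i) ^ 2 := by
        refine Finset.sum_congr rfl fun j _ => Finset.sum_congr rfl fun i _ => ?_
        by_cases hij : inner ℝ (u j) (v i) = 0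
        · simp [hij]
        · rw [h' i j hij]
    _ = ∑ i, f (s' i) := by
        rw [Finset.sum_comm]
        refine Finset.sum_congr rfl fun i _ => ?_
        rw [← Finset.mul_sum, u.sum_sq_inner_right]; simp

/-- Counting entries that are at least `s i`: if `s' i < s i`, there are at least `i + 1` of them in
`s` but at most `i` in `s'`. -/
theorem le_of_antitone_of_sum_comp_eq {s s' : Fin n → ℝ} (hs : Antitone s) (hs' : Antitone s')
    (h : ∀ f : ℝ → ℝ, ∑ j, f (s j) = ∑ i, f (s' i)) (i : Fin n) : s i ≤ s' i := by
  by_contra! hlt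
  have hc := h fun x => if s i ≤ x then 1 else 0
  simp only [Finset.sum_boole, Nat.cast_inj] at hc
  have h1 : Finset.Iic i ⊆ ({j | s i ≤ s j} : Finset (Fin n)) := fun j hj => by
    simpa using hs (Finset.mem_Iic.1 hj)
  have h2 : ({j | s i ≤ s' j} : Finset (Fin n)) ⊆ Finset.Iio i := fun j hj => by
    simp only [Finset.mem_filter, Finset.mem_univ, true_and] at hj
    rw [Finset.mem_Iio]
    by_contra! hij
    exact absurd (hs' hij) (by linarith)
  have h3 := Finset.card_le_card h1
  have h4 := Finset.card_le_card h2
  rw [Fin.card_Iic] at h3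
  rw [Fin.card_Iio] at h4
  omega

/-- A decreasing enumeration of eigenvalues is determined by the operator. -/
theorem eigenvalues_eq_of_diagOp_eq {u v : OrthonormalBasis (Fin n) ℝ E} {s s' : Fin n → ℝ}
    (hs : Antitone s) (hs' : Antitone s') (h : diagOp u s = diagOp v s') : s = s' :=
  funext fun i => le_antisymm
    (le_of_antitone_of_sum_comp_eq hs hs' (sum_comp_eq_of_diagOp_eq h) i)
    (le_of_antitone_of_sum_comp_eq hs' hs (sum_comp_eq_of_diagOp_eq h.symm) i)

/-- The excess of the weighted sum over the tail sum, as a sum of terms that are nonnegative for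
weights in `[0, 1]` of total mass at most `K` when `t` separates the head of `s` from its tail. -/
theorem sum_mul_one_sub_eq (s w : Fin n → ℝ) (K : ℕ) (hK : K ≤ n) (t : ℝ) :
    ∑ i, s i * (1 - w i) - ∑ i, (s i - truncSeq s K i) =
      ∑ i, (if i.val < K then (s i - t) * (1 - w i) else (t - s i) * w i) +
        t * (K - ∑ i, w i) := by
  have hcard : ((K : ℕ) : ℝ) = ∑ i : Fin n, if i.val < K then (1 : ℝ) else 0 := by
    rw [Finset.sum_boole]
    congr 1
    rw [Fin.card_filter_val_lt, min_eq_right hK]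
  rw [hcard, ← Finset.sum_sub_distrib, ← Finset.sum_sub_distrib, Finset.mul_sum,
    ← Finset.sum_add_distrib]
  refine Finset.sum_congr rfl fun i _ => ?_
  unfold truncSeq
  split_ifs <;> ring

theorem finrank_range_diagOp_truncSeq_le (u : OrthonormalBasis (Fin n) ℝ E) (s : Fin n → ℝ)
    (K : ℕ) : Module.finrank ℝ (LinearMap.range (diagOp u (truncSeq s K))) ≤ K := by
  classical
  set F : Finset E := ({i : Fin n | i.val < K} : Finset (Fin n)).image u
  have hle : LinearMap.range (diagOp u (truncSeq s K)) ≤ Submodule.span ℝ (F : Set E) := by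
    rintro _ ⟨x, rfl⟩
    rw [diagOp_apply]
    refine Submodule.sum_mem _ fun i _ => ?_
    by_cases hi : i.val < K
    · exact Submodule.smul_mem _ _ (Submodule.subset_span (by
        rw [Finset.mem_coe]; exact Finset.mem_image_of_mem _ (by simpa using hi)))
    · simp [truncSeq, hi]
  refine (Submodule.finrank_mono hle).trans ((finrank_span_finset_le_card F).trans ?_)
  refine Finset.card_image_le.trans ?_
  rw [Fin.card_filter_val_lt]
  exact min_le_right _ _

variable [FiniteDimensional ℝ E]

/-- Pythagoras: the error of `T` splits along the range of `T` and its complement. -/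
theorem sum_norm_sq_sub_eq (u : OrthonormalBasis (Fin n) ℝ E) (s : Fin n → ℝ) (T : E →ₗ[ℝ] E) :
    ∑ i, ‖T (u i) - s i • u i‖ ^ 2 =
      ∑ i, ‖T (u i) - s i • (LinearMap.range T).starProjection (u i)‖ ^ 2 +
        ∑ i, s i ^ 2 * (1 - ‖(LinearMap.range T).starProjection (u i)‖ ^ 2) := by
  set V := LinearMap.range T
  rw [← Finset.sum_add_distrib]
  refine Finset.sum_congr rfl fun i _ => ?_
  have h1 : T (u i) - s i • u i = (T (u i) - s i • V.starProjection (u i)) +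
      (-s i) • (u i - V.starProjection (u i)) := by module
  have h2 : inner ℝ (T (u i) - s i • V.starProjection (u i))
      ((-s i) • (u i - V.starProjection (u i))) = 0 := by
    rw [real_inner_smul_right, real_inner_comm, V.starProjection_inner_eq_zero, mul_zero]
    exact V.sub_mem ⟨u i, rfl⟩ (V.smul_mem _ (V.starProjection_apply_mem _))
  have h3 : inner ℝ (u i - V.starProjection (u i)) (V.starProjection (u i)) = 0 :=
    V.starProjection_inner_eq_zero _ _ (V.starProjection_apply_mem _)
  have h4 : ‖u i‖ ^ 2 = ‖u i - V.starProjection (u i)‖ ^ 2 + ‖V.starProjection (u i)‖ ^ 2 := by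
    conv_lhs => rw [← sub_add_cancel (u i) (V.starProjection (u i))]
    rw [norm_add_sq_real, h3]; ring
  rw [u.norm_eq_one] at h4
  rw [h1, norm_add_sq_real, h2, norm_smul, mul_pow, norm_neg, Real.norm_eq_abs, sq_abs]
  linear_combination (-(s i ^ 2)) * h4

theorem norm_sq_starProjection_basis_le_one (u : OrthonormalBasis (Fin n) ℝ E)
    (V : Submodule ℝ E) (i : Fin n) : ‖V.starProjection (u i)‖ ^ 2 ≤ 1 := by
  have h := V.norm_starProjection_apply_le (u i)
  rw [u.norm_eq_one] at h
  exact pow_le_one₀ (norm_nonneg _) h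

/-- Lower bound in the Eckart-Young theorem for a positive semidefinite operator. -/
theorem tail_le_sum_norm_sq_sub (u : OrthonormalBasis (Fin n) ℝ E) {s : Fin n → ℝ}
    (hs : Antitone s) (h0 : ∀ i, 0 ≤ s i) (K : ℕ) (T : E →ₗ[ℝ] E)
    (hT : Module.finrank ℝ (LinearMap.range T) ≤ K) :
    ∑ i, (s i ^ 2 - truncSeq (fun i => s i ^ 2) K i) ≤ ∑ i, ‖T (u i) - s i • u i‖ ^ 2 := by
  rcases le_or_gt n K with hK | hK
  · refine le_trans (le_of_eq ?_) (Finset.sum_nonneg fun i _ => by positivity)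
    refine Finset.sum_eq_zero fun i _ => ?_
    simp [truncSeq, i.isLt.trans_le hK]
  rw [sum_norm_sq_sub_eq]
  set V := LinearMap.range T
  -- The threshold is the first discarded squared eigenvalue: positions start at `0`, so it sits at
  -- position `K`. It makes every term on the right nonnegative.
  have hid := sum_mul_one_sub_eq (fun i => s i ^ 2) (fun i => ‖V.starProjection (u i)‖ ^ 2) K hK.le
    (s ⟨K, hK⟩ ^ 2)
  rw [sum_norm_sq_starProjection u V] at hid
  have hnn : 0 ≤ ∑ i, ‖T (u i) - s i • V.starProjection (u i)‖ ^ 2 :=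
    Finset.sum_nonneg fun i _ => by positivity
  have hterm : 0 ≤ ∑ i : Fin n, (if i.val < K then
      (s i ^ 2 - s ⟨K, hK⟩ ^ 2) * (1 - ‖V.starProjection (u i)‖ ^ 2)
      else (s ⟨K, hK⟩ ^ 2 - s i ^ 2) * ‖V.starProjection (u i)‖ ^ 2) := by
    refine Finset.sum_nonneg fun i _ => ?_
    split_ifs with hi
    · exact mul_nonneg (sub_nonneg.2 (pow_le_pow_left₀ (h0 _) (hs (Fin.le_def.2 hi.le)) 2))
        (sub_nonneg.2 (norm_sq_starProjection_basis_le_one u V i))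
    · exact mul_nonneg (sub_nonneg.2 (pow_le_pow_left₀ (h0 _) (hs (Fin.le_def.2 (not_lt.1 hi))) 2))
        (by positivity)
  have hlast : 0 ≤ s ⟨K, hK⟩ ^ 2 * ((K : ℝ) - Module.finrank ℝ V) :=
    mul_nonneg (by positivity) (sub_nonneg.2 (by exact_mod_cast hT))
  linarith

/-- The spectral truncation attains the Eckart-Young bound. -/
theorem sum_norm_sq_sub_truncation (u v : OrthonormalBasis (Fin n) ℝ E) (s : Fin n → ℝ) (K : ℕ)
    (h : diagOp v s = diagOp u s) :
    ∑ i, ‖diagOp v (truncSeq s K) (u i) - s i • u i‖ ^ 2 =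
      ∑ i, (s i ^ 2 - truncSeq (fun i => s i ^ 2) K i) := by
  calc ∑ i, ‖diagOp v (truncSeq s K) (u i) - s i • u i‖ ^ 2
      = ∑ i, ‖(diagOp v (truncSeq s K) - diagOp v s) (u i)‖ ^ 2 := by
        simp [h]
    _ = ∑ i, ‖(diagOp v (truncSeq s K) - diagOp v s) (v i)‖ ^ 2 :=
        sum_norm_sq_apply_basis_eq _ _ _
    _ = _ := by
        refine Finset.sum_congr rfl fun i _ => ?_
        rw [LinearMap.sub_apply, diagOp_basis, diagOp_basis, ← sub_smul, norm_smul, v.norm_eq_one,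
          mul_one, Real.norm_eq_abs, sq_abs]
        unfold truncSeq
        split_ifs <;> ring

end SpectralTruncation

/-! ### The equality case of Eckart-Young -/

section SpectralTruncation

variable {E : Type*} [NormedAddCommGroup E] [InnerProductSpace ℝ E] {n : ℕ}
variable [FiniteDimensional ℝ E]

/-- A subspace of dimension `K` that contains the eigenvectors with eigenvalue above `t` and is
orthogonal to those with eigenvalue below `t` is spanned by the leading vectors of some sorted
eigenbasis. -/
theorem exists_basis_of_starProjection (u : OrthonormalBasis (Fin n) ℝ E) {s : Fin n → ℝ}
    (hs : Antitone s) (t : ℝ) (V : Submodule ℝ E)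
    (hgt : ∀ i, t < s i → V.starProjection (u i) = u i)
    (hlt : ∀ i, s i < t → V.starProjection (u i) = 0) :
    ∃ v : OrthonormalBasis (Fin n) ℝ E, diagOp v s = diagOp u s ∧
      ∀ i, V.starProjection (v i) = if i.val < Module.finrank ℝ V then v i else 0 := by
  classical
  have hn : Module.finrank ℝ E = n := by simpa using Module.finrank_eq_card_basis u.toBasis
  set Q : E →ₗ[ℝ] E := (V.starProjection : E →L[ℝ] E).toLinearMap with hQ
  set D := diagOp u s with hD
  have hQs : Q.IsSymmetric := fun x y => V.inner_starProjection_left_eq_right x y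
  have hDs : D.IsSymmetric := diagOp_isSymmetric u s
  have hQQ (x : E) : Q (Q x) = Q x :=
    V.starProjection_eq_self_iff.2 (V.starProjection_apply_mem x)
  -- `Q` and `D` commute
  have hcomm : D ∘ₗ Q = Q ∘ₗ D := by
    refine u.toBasis.ext fun i => ?_
    simp only [OrthonormalBasis.coe_toBasis, LinearMap.comp_apply]
    rw [hD, diagOp_basis, map_smul]
    refine u.repr.injective (PiLp.ext fun j => ?_)
    rw [u.repr_apply_apply, u.repr_apply_apply, inner_diagOp, real_inner_smul_right]
    -- Only for `s i = t` is `Q (u i)` unknown; then `s j ≠ t`, and symmetry moves `Q` onto `u j`,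
    -- where it is known.
    by_cases hij : s j = s i
    · rw [hij]
    have hzero : inner ℝ (u j) (u i) = 0 := u.inner_eq_zero fun h => hij (by rw [h])
    have : inner ℝ (u j) (Q (u i)) = 0 := by
      rcases lt_trichotomy (s i) t with h | h | h
      · rw [show Q (u i) = 0 from hlt i h, inner_zero_right]
      · rw [← hQs]
        rcases lt_or_gt_of_ne (h ▸ hij : s j ≠ t) with h' | h'
        · rw [show Q (u j) = 0 from hlt j h', inner_zero_left]
        · rw [show Q (u j) = u j from hgt j h', hzero]
      · rw [show Q (u i) = u i from hgt i h, hzero]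
    rw [this]; ring
  have hcomm' (x : E) : D (Q x) = Q (D x) := LinearMap.congr_fun hcomm x
  -- Adding `Q` raises `D` by one on `V` only. As `D ≥ t` on `V` and `D ≤ t` on its complement, the
  -- spectrum splits into parts above `t + 1` and below `t`; hence each eigenvector of `D + Q` lies
  -- in `V` or in its complement, and sorting lists those in `V` first, even when `D` has ties at
  -- `t`.
  have hAs : (D + Q).IsSymmetric := hDs.add hQs
  set α := hAs.eigenvalues hn with hα
  set v := hAs.eigenvectorBasis hn with hv
  have hαanti : Antitone α := hAs.eigenvalues_antitone hn
  have hAv (i : Fin n) : D (v i) + Q (v i) = α i • v i := by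
    simpa using hAs.apply_eigenvectorBasis hn i
  have hDQ (i : Fin n) : D (Q (v i)) = (α i - 1) • Q (v i) := by
    have h := congrArg Q (hAv i)
    rw [map_add, hQQ, map_smul, ← hcomm'] at h
    rw [sub_smul, one_smul, ← h, add_sub_cancel_right]
  have hDq (i : Fin n) : D (v i - Q (v i)) = α i • (v i - Q (v i)) := by
    rw [map_sub, hDQ, eq_sub_of_add_eq (hAv i)]
    module
  have hge (i : Fin n) (hne : Q (v i) ≠ 0) : t + 1 ≤ α i := by
    have h1 : (α i - 1 - t) * ‖Q (v i)‖ ^ 2 = ∑ j, (s j - t) * inner ℝ (u j) (Q (v i)) ^ 2 := by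
      simp_rw [sub_mul (s _) t, Finset.sum_sub_distrib, ← Finset.mul_sum]
      rw [u.sum_sq_inner_right, ← inner_diagOp_self, ← hD, hDQ, real_inner_smul_right,
        real_inner_self_eq_norm_sq]
      ring
    have h2 : 0 ≤ ∑ j, (s j - t) * inner ℝ (u j) (Q (v i)) ^ 2 := by
      refine Finset.sum_nonneg fun j _ => ?_
      rcases lt_or_ge (s j) t with h | h
      · rw [← hQs, show Q (u j) = 0 from hlt j h, inner_zero_left]; simp
      · exact mul_nonneg (sub_nonneg.2 h) (sq_nonneg _)
    rw [← h1] at h2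
    have := nonneg_of_mul_nonneg_left h2 (by positivity)
    linarith
  have hle (i : Fin n) (hne : v i - Q (v i) ≠ 0) : α i ≤ t := by
    have h1 : (t - α i) * ‖v i - Q (v i)‖ ^ 2 =
        ∑ j, (t - s j) * inner ℝ (u j) (v i - Q (v i)) ^ 2 := by
      simp_rw [sub_mul t (s _), Finset.sum_sub_distrib, ← Finset.mul_sum]
      rw [u.sum_sq_inner_right, ← inner_diagOp_self, ← hD, hDq, real_inner_smul_right,
        real_inner_self_eq_norm_sq]
      ring
    have h2 : 0 ≤ ∑ j, (t - s j) * inner ℝ (u j) (v i - Q (v i)) ^ 2 := by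
      refine Finset.sum_nonneg fun j _ => ?_
      rcases lt_or_ge t (s j) with h | h
      · rw [inner_sub_right, ← hQs, show Q (u j) = u j from hgt j h]; simp
      · exact mul_nonneg (sub_nonneg.2 h) (sq_nonneg _)
    rw [← h1] at h2
    have := nonneg_of_mul_nonneg_left h2 (by positivity)
    linarith
  have hcases (i : Fin n) : (t + 1 ≤ α i ∧ Q (v i) = v i) ∨ (α i ≤ t ∧ Q (v i) = 0) := by
    by_cases h1 : Q (v i) = 0
    · refine Or.inr ⟨hle i ?_, h1⟩
      rw [h1, sub_zero]
      exact v.orthonormal.ne_zero i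
    · refine Or.inl ⟨hge i h1, ?_⟩
      by_contra h2
      have := hle i (sub_ne_zero.2 (Ne.symm h2))
      linarith [hge i h1]
  -- the number of indices with `Q (v i) = v i` is the dimension of `V`
  set I : Finset (Fin n) := {i | t + 1 ≤ α i} with hI
  have hcardI : I.card = Module.finrank ℝ V := by
    have h := sum_norm_sq_starProjection v V
    have h' : ∑ i, ‖V.starProjection (v i)‖ ^ 2 = ∑ i, if t + 1 ≤ α i then (1 : ℝ) else 0 := by
      refine Finset.sum_congr rfl fun i _ => ?_
      change ‖Q (v i)‖ ^ 2 = _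
      rcases hcases i with ⟨h1, h2⟩ | ⟨h1, h2⟩
      · rw [if_pos h1, h2, v.norm_eq_one]; norm_num
      · rw [if_neg (by linarith), h2]; norm_num
    rw [h', Finset.sum_boole] at h
    exact_mod_cast h
  have hmem (i : Fin n) : t + 1 ≤ α i ↔ i.val < Module.finrank ℝ V := by
    rw [← hcardI]
    constructor
    · intro hi
      have : Finset.Iic i ⊆ I := fun j hj => by
        rw [hI, Finset.mem_filter]
        exact ⟨Finset.mem_univ _, hi.trans (hαanti (Finset.mem_Iic.1 hj))⟩
      have := Finset.card_le_card this
      rw [Fin.card_Iic] at this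
      omega
    · intro hi
      by_contra hcon
      have : I ⊆ Finset.Iio i := fun j hj => by
        rw [hI, Finset.mem_filter] at hj
        rw [Finset.mem_Iio]
        by_contra! hij
        exact hcon (hj.2.trans (hαanti hij))
      have := Finset.card_le_card this
      rw [Fin.card_Iio] at this
      omega
  have hQv (i : Fin n) : Q (v i) = if i.val < Module.finrank ℝ V then v i else 0 := by
    rcases hcases i with ⟨h1, h2⟩ | ⟨h1, h2⟩
    · rw [if_pos ((hmem i).1 h1), h2]
    · rw [if_neg (fun h => by linarith [(hmem i).2 h]), h2]
  -- Undoing the shift keeps the order, since `α i - 1 ≥ t ≥ α j` across the cut. Uniqueness of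
  -- sorted eigenvalues then gives `β = s`.
  set β : Fin n → ℝ := fun i => if i.val < Module.finrank ℝ V then α i - 1 else α i with hβ
  have hβanti : Antitone β := by
    intro i j hij
    have hij' : i.val ≤ j.val := hij
    have := hαanti hij
    simp only [hβ]
    split_ifs with h1 h2 h2
    · linarith
    · omega
    · have h3 := (hmem i).2 h2
      rcases hcases j with ⟨h4, -⟩ | ⟨h4, -⟩
      · exact absurd ((hmem j).1 h4) h1
      · linarith
    · exact this
  have hDv : diagOp v β = D := by
    refine v.toBasis.ext fun i => ?_
    rw [OrthonormalBasis.coe_toBasis, diagOp_basis, eq_sub_of_add_eq (hAv i), hQv i]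
    simp only [hβ]
    split_ifs
    · module
    · simp
  have hβs : β = s := eigenvalues_eq_of_diagOp_eq hβanti hs (hDv.trans hD)
  exact ⟨v, hβs ▸ hDv, hQv⟩

/-- Equality case of the Eckart-Young theorem for a positive semidefinite operator. -/
theorem exists_eq_diagOp_truncSeq (u : OrthonormalBasis (Fin n) ℝ E) {s : Fin n → ℝ}
    (hs : Antitone s) (h0 : ∀ i, 0 ≤ s i) (K : ℕ) (T : E →ₗ[ℝ] E)
    (hT : Module.finrank ℝ (LinearMap.range T) ≤ K)
    (heq : ∑ i, ‖T (u i) - s i • u i‖ ^ 2 ≤ ∑ i, (s i ^ 2 - truncSeq (fun i => s i ^ 2) K i)) :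
    ∃ v : OrthonormalBasis (Fin n) ℝ E, diagOp v s = diagOp u s ∧
      T = diagOp v (truncSeq s K) := by
  -- With a zero tail the minimal error is zero and `T` is the whole operator. Its rank may be below
  -- `K`, so the dimension count used in the other case would fail here.
  by_cases htail : ∀ i : Fin n, K ≤ i.val → s i = 0
  · have hts : truncSeq s K = s := by
      funext i
      unfold truncSeq
      split_ifs with hi
      · rfl
      · exact (htail i (not_lt.1 hi)).symm
    refine ⟨u, rfl, ?_⟩
    have hzero : ∑ i, (s i ^ 2 - truncSeq (fun i => s i ^ 2) K i) = 0 := by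
      refine Finset.sum_eq_zero fun i _ => ?_
      unfold truncSeq
      split_ifs with hi
      · ring
      · rw [htail i (not_lt.1 hi)]; ring
    rw [hzero] at heq
    have hall := (Finset.sum_eq_zero_iff_of_nonneg (fun i _ => by positivity)).1
      (le_antisymm heq (Finset.sum_nonneg fun i _ => by positivity))
    rw [hts]
    refine u.toBasis.ext fun i => ?_
    rw [OrthonormalBasis.coe_toBasis, diagOp_basis]
    exact sub_eq_zero.1 (norm_eq_zero.1 (pow_eq_zero_iff (two_ne_zero) |>.1
      (hall i (Finset.mem_univ i))))
  push Not at htail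
  obtain ⟨i₀, hi₀, hsi₀⟩ := htail
  have hK : K < n := hi₀.trans_lt i₀.isLt
  set t := s ⟨K, hK⟩ with ht
  have htpos : 0 < t := ((h0 i₀).lt_of_ne' hsi₀).trans_le (hs (Fin.le_def.2 hi₀))
  rw [sum_norm_sq_sub_eq] at heq
  set V := LinearMap.range T
  have hid := sum_mul_one_sub_eq (fun i => s i ^ 2) (fun i => ‖V.starProjection (u i)‖ ^ 2) K hK.le
    (t ^ 2)
  rw [sum_norm_sq_starProjection u V] at hid
  have hnn : 0 ≤ ∑ i, ‖T (u i) - s i • V.starProjection (u i)‖ ^ 2 :=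
    Finset.sum_nonneg fun i _ => by positivity
  have hterm (i : Fin n) : 0 ≤ (if i.val < K then
      (s i ^ 2 - t ^ 2) * (1 - ‖V.starProjection (u i)‖ ^ 2)
      else (t ^ 2 - s i ^ 2) * ‖V.starProjection (u i)‖ ^ 2) := by
    split_ifs with hi
    · exact mul_nonneg (sub_nonneg.2 (pow_le_pow_left₀ (h0 _) (hs (Fin.le_def.2 hi.le)) 2))
        (sub_nonneg.2 (norm_sq_starProjection_basis_le_one u V i))
    · exact mul_nonneg (sub_nonneg.2 (pow_le_pow_left₀ (h0 _) (hs (Fin.le_def.2 (not_lt.1 hi))) 2))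
        (by positivity)
  have hsum := Finset.sum_nonneg fun i (_ : i ∈ Finset.univ) => hterm i
  have hlast : 0 ≤ t ^ 2 * ((K : ℝ) - Module.finrank ℝ V) :=
    mul_nonneg (by positivity) (sub_nonneg.2 (by exact_mod_cast hT))
  -- The lower bound is a sum of nonnegative terms, so equality makes each vanish; `t > 0` turns the
  -- last one into `dim V = K`.
  have hrank : Module.finrank ℝ V = K := by
    have h : t ^ 2 * ((K : ℝ) - Module.finrank ℝ V) = 0 := by linarith
    have h' := (mul_eq_zero.1 h).resolve_left (by positivity)
    exact_mod_cast (sub_eq_zero.1 h').symm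
  have hTQ (i : Fin n) : T (u i) = s i • V.starProjection (u i) := by
    have h := (Finset.sum_eq_zero_iff_of_nonneg (fun i _ => by positivity)).1
      (show ∑ i, ‖T (u i) - s i • V.starProjection (u i)‖ ^ 2 = 0 by linarith)
      i (Finset.mem_univ i)
    exact sub_eq_zero.1 (norm_eq_zero.1 ((pow_eq_zero_iff two_ne_zero).1 h))
  have hterm0 (i : Fin n) := (Finset.sum_eq_zero_iff_of_nonneg (fun i _ => hterm i)).1
      (by linarith) i (Finset.mem_univ i)
  have hgt (i : Fin n) (hi : t < s i) : V.starProjection (u i) = u i := by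
    have hiK : i.val < K := by
      by_contra! h
      exact absurd (hs (Fin.le_def.2 h : (⟨K, hK⟩ : Fin n) ≤ i)) (not_le.2 hi)
    have h := hterm0 i
    rw [if_pos hiK] at h
    have h1 : ‖V.starProjection (u i)‖ ^ 2 = 1 := by
      have := (mul_eq_zero.1 h).resolve_left
        (sub_ne_zero.2 (pow_lt_pow_left₀ hi htpos.le two_ne_zero).ne')
      linarith
    rw [V.starProjection_eq_self_iff, V.mem_iff_norm_starProjection, u.norm_eq_one]
    exact (pow_eq_one_iff_of_nonneg (norm_nonneg _) two_ne_zero).1 h1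
  have hlt (i : Fin n) (hi : s i < t) : V.starProjection (u i) = 0 := by
    have hiK : ¬ i.val < K := fun h =>
      absurd (hs (Fin.le_def.2 h.le : i ≤ (⟨K, hK⟩ : Fin n))) (not_le.2 hi)
    have h := hterm0 i
    rw [if_neg hiK] at h
    have := (mul_eq_zero.1 h).resolve_left
        (sub_ne_zero.2 (pow_lt_pow_left₀ hi (h0 i) two_ne_zero).ne')
    exact norm_eq_zero.1 ((pow_eq_zero_iff two_ne_zero).1 this)
  obtain ⟨v, hv, hQv⟩ := exists_basis_of_starProjection u hs t V hgt hlt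
  refine ⟨v, hv, v.toBasis.ext fun i => ?_⟩
  have hTD : T = (V.starProjection : E →L[ℝ] E).toLinearMap ∘ₗ diagOp u s := by
    refine u.toBasis.ext fun j => ?_
    simp [hTQ j]
  rw [OrthonormalBasis.coe_toBasis, diagOp_basis, hTD, ← hv, LinearMap.comp_apply, diagOp_basis,
    map_smul, ContinuousLinearMap.coe_coe, hQv i, hrank]
  unfold truncSeq
  split_ifs <;> simp

end SpectralTruncation

/-! ### Translation between matrices and operators -/

section Matrices

variable {n : ℕ}

theorem act_eq_toEuclideanLin (M : Matrix (Fin n) (Fin n) ℝ) (y : Vec n) :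
    act M y = Matrix.toEuclideanLin M y := rfl

theorem toEuclideanLin_vecMulVec (v : Vec n) :
    Matrix.toEuclideanLin (Matrix.vecMulVec v.ofLp v.ofLp) =
      (InnerProductSpace.rankOne ℝ v v : Vec n →L[ℝ] Vec n).toLinearMap := by
  ext x i
  simp [Matrix.toLpLin_apply, Matrix.vecMulVec_mulVec, PiLp.inner_apply, dotProduct,
    mul_comm]

theorem toEuclideanLin_sum_smul_vecMulVec (v : OrthonormalBasis (Fin n) ℝ (Vec n))
    (d : Fin n → ℝ) (K : ℕ) :
    Matrix.toEuclideanLin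
        (∑ i : Fin n with i.val < K, d i • Matrix.vecMulVec (v i).ofLp (v i).ofLp) =
      diagOp v (truncSeq d K) := by
  rw [map_sum, diagOp, Finset.sum_filter]
  refine Finset.sum_congr rfl fun i _ => ?_
  unfold truncSeq
  split_ifs
  · rw [map_smul, toEuclideanLin_vecMulVec]
  · rw [zero_smul]

theorem toEuclideanLin_eigenTrunc (lam : Fin n → ℝ) (v : OrthonormalBasis (Fin n) ℝ (Vec n))
    (K : ℕ) : Matrix.toEuclideanLin (eigenTrunc lam v K) = diagOp v (truncSeq lam K) :=
  toEuclideanLin_sum_smul_vecMulVec v lam K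

theorem toEuclideanLin_optimalMap (lam : Fin n → ℝ) (v : OrthonormalBasis (Fin n) ℝ (Vec n))
    (K : ℕ) (σ : ℝ) : Matrix.toEuclideanLin (optimalMap lam v K σ) =
      diagOp v (truncSeq (fun i => lam i / (lam i + σ ^ 2)) K) :=
  toEuclideanLin_sum_smul_vecMulVec v _ K

theorem isSortedEigenbasis_iff {C : Matrix (Fin n) (Fin n) ℝ} {lam : Fin n → ℝ}
    {u : OrthonormalBasis (Fin n) ℝ (Vec n)} :
    IsSortedEigenbasis C lam u ↔ Antitone lam ∧ Matrix.toEuclideanLin C = diagOp u lam := by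
  refine and_congr_right fun _ => ⟨fun h => u.toBasis.ext fun i => ?_, fun h i => ?_⟩
  · rw [OrthonormalBasis.coe_toBasis, diagOp_basis]; exact h i
  · rw [act_eq_toEuclideanLin, h, diagOp_basis]

theorem finrank_range_toEuclideanLin (M : Matrix (Fin n) (Fin n) ℝ) :
    Module.finrank ℝ (LinearMap.range (Matrix.toEuclideanLin M)) = M.rank := by
  rw [Matrix.rank_eq_finrank_range_toLin M (EuclideanSpace.basisFun (Fin n) ℝ).toBasis
    (EuclideanSpace.basisFun (Fin n) ℝ).toBasis, Matrix.toEuclideanLin_eq_toLin_orthonormal]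

theorem sum_sq_entries_eq (M : Matrix (Fin n) (Fin n) ℝ)
    (u : OrthonormalBasis (Fin n) ℝ (Vec n)) :
    ∑ i, ∑ j, M i j ^ 2 = ∑ i, ‖Matrix.toEuclideanLin M (u i)‖ ^ 2 := by
  rw [sum_norm_sq_apply_basis_eq u (EuclideanSpace.basisFun (Fin n) ℝ), Finset.sum_comm]
  refine Finset.sum_congr rfl fun j _ => ?_
  rw [EuclideanSpace.real_norm_sq_eq]
  refine Finset.sum_congr rfl fun i _ => ?_
  simp [Matrix.toLpLin_apply]

/-- A linear map of rank at most `K` factors through a bottleneck of size `K`. -/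
theorem exists_bottleneck_factorization {K : ℕ} (L : Vec n →ₗ[ℝ] Vec n)
    (hL : Module.finrank ℝ (LinearMap.range L) ≤ K) :
    ∃ (A : Matrix (Fin n) (Fin K) ℝ) (B : Matrix (Fin K) (Fin n) ℝ),
      Matrix.toEuclideanLin (A * B) = L := by
  obtain ⟨f, hf⟩ : ∃ f : LinearMap.range L →ₗ[ℝ] EuclideanSpace ℝ (Fin K),
      Function.Injective f := by
    refine finrank_le_iff_exists_linearMap.1 ?_
    simpa using hL
  obtain ⟨g, hg⟩ := f.exists_leftInverse_of_injective (LinearMap.ker_eq_bot.2 hf)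
  -- The encoder is `L` followed by an embedding of its range into `ℝᴷ`; the decoder is a left
  -- inverse of that embedding.
  refine ⟨Matrix.toEuclideanLin.symm ((LinearMap.range L).subtype ∘ₗ g),
    Matrix.toEuclideanLin.symm (f ∘ₗ L.rangeRestrict), ?_⟩
  rw [Matrix.toEuclideanLin, Matrix.toLpLin_mul 2 2 2]
  refine LinearMap.ext fun x => ?_
  simpa using congrArg Subtype.val (LinearMap.congr_fun hg (L.rangeRestrict x))

theorem finrank_range_mul_le {K : ℕ} (A : Matrix (Fin n) (Fin K) ℝ)
    (B : Matrix (Fin K) (Fin n) ℝ) :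
    Module.finrank ℝ (LinearMap.range (Matrix.toEuclideanLin (A * B))) ≤ K := by
  rw [finrank_range_toEuclideanLin]
  exact (Matrix.rank_mul_le_left A B).trans (Matrix.rank_le_width A)

/-- Eckart-Young for positive semidefinite matrices. -/
theorem isBestRankApprox_eigenTrunc {C : Matrix (Fin n) (Fin n) ℝ} {lam : Fin n → ℝ}
    {u : OrthonormalBasis (Fin n) ℝ (Vec n)} (hu : IsSortedEigenbasis C lam u)
    (h0 : ∀ i, 0 ≤ lam i) (K : ℕ) : IsBestRankApprox K C (eigenTrunc lam u K) := by
  obtain ⟨hanti, hC⟩ := isSortedEigenbasis_iff.1 hu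
  have hdist (X : Matrix (Fin n) (Fin n) ℝ) : ∑ i, ∑ j, (C i j - X i j) ^ 2 =
      ∑ i, ‖Matrix.toEuclideanLin X (u i) - lam i • u i‖ ^ 2 := by
    have h := sum_sq_entries_eq (C - X) u
    simp only [Matrix.sub_apply] at h
    rw [h]
    refine Finset.sum_congr rfl fun i _ => ?_
    rw [map_sub, LinearMap.sub_apply, hC, diagOp_basis, norm_sub_rev]
  refine ⟨?_, fun X hX => ?_⟩
  · rw [← finrank_range_toEuclideanLin, toEuclideanLin_eigenTrunc]
    exact finrank_range_diagOp_truncSeq_le u lam K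
  · rw [hdist, hdist, toEuclideanLin_eigenTrunc, sum_norm_sq_sub_truncation u u lam K rfl]
    exact tail_le_sum_norm_sq_sub u hanti h0 K _ ((finrank_range_toEuclideanLin X).trans_le hX)

end Matrices

/-! ### The error of an affine denoiser -/

section MeanSquaredError

variable {n : ℕ} {P : Measure (Vec n)}

theorem memLp_inner (hP : MemLp id 2 P) (l : Vec n) : MemLp (fun x => inner ℝ l x) 2 P :=
  hP.const_inner l

variable [IsProbabilityMeasure P]

theorem variance_inner_eq (hP : MemLp id 2 P) (l : Vec n) :
    Var[fun x => inner ℝ l x; P] = inner ℝ l (act (covMat P) l) := by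
  have hcoord (i : Fin n) : MemLp (fun x : Vec n => x i) 2 P := by
    simpa [EuclideanSpace.inner_single_left] using
      memLp_inner hP (EuclideanSpace.basisFun (Fin n) ℝ i)
  have hfun : (fun x : Vec n => inner ℝ l x) = fun x => ∑ i, l i * x i := by
    ext x; simp [PiLp.inner_apply, mul_comm]
  rw [hfun, variance_fun_sum fun i => (hcoord i).const_mul (l i)]
  simp only [PiLp.inner_apply, act, Matrix.mulVec, dotProduct, covMat, Matrix.of_apply]
  refine Finset.sum_congr rfl fun i _ => ?_
  simp only [covariance_const_mul_left, covariance_const_mul_right, RCLike.inner_apply, conj_trivial,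
    Finset.sum_mul]
  refine Finset.sum_congr rfl fun j _ => ?_
  ring

theorem variance_inner_eq_sum (hP : MemLp id 2 P) {lam : Fin n → ℝ}
    {u : OrthonormalBasis (Fin n) ℝ (Vec n)} (hu : IsSortedEigenbasis (covMat P) lam u)
    (l : Vec n) : Var[fun x => inner ℝ l x; P] = ∑ i, lam i * inner ℝ (u i) l ^ 2 := by
  rw [variance_inner_eq hP, act_eq_toEuclideanLin, (isSortedEigenbasis_iff.1 hu).2,
    inner_diagOp_self]

theorem eigenvalues_covMat_nonneg (hP : MemLp id 2 P) {lam : Fin n → ℝ}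
    {u : OrthonormalBasis (Fin n) ℝ (Vec n)} (hu : IsSortedEigenbasis (covMat P) lam u)
    (i : Fin n) : 0 ≤ lam i := by
  have h := variance_nonneg (fun x => inner ℝ (u i) x) P
  rwa [variance_inner_eq hP, hu.2, real_inner_smul_right, real_inner_self_eq_norm_sq,
    u.norm_eq_one, one_pow, mul_one] at h

theorem variance_inner_stdGaussian (l : Vec n) :
    Var[fun z => inner ℝ l z; stdGaussian (Vec n)] = ‖l‖ ^ 2 := by
  have h := variance_dual_stdGaussian (innerSL ℝ l)
  rwa [innerSL_apply_norm] at h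

/-- Second moment of a sum of independent variables, the second of which is centred. -/
theorem integral_add_sq_prod {X Y : Vec n → ℝ} {Q : Measure (Vec n)} [IsProbabilityMeasure Q]
    (hX : MemLp X 2 P) (hY : MemLp Y 2 Q) (hY0 : ∫ z, Y z ∂Q = 0) :
    Integrable (fun p : Vec n × Vec n => (X p.1 + Y p.2) ^ 2) (P.prod Q) ∧
      ∫ p, (X p.1 + Y p.2) ^ 2 ∂(P.prod Q) = Var[X; P] + Var[Y; Q] + (∫ x, X x ∂P) ^ 2 := by
  have hX' : MemLp (fun p : Vec n × Vec n => X p.1) 2 (P.prod Q) := hX.comp_fst Q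
  have hY' : MemLp (fun p : Vec n × Vec n => Y p.2) 2 (P.prod Q) := hY.comp_snd P
  have hadd : MemLp (fun p : Vec n × Vec n => X p.1 + Y p.2) 2 (P.prod Q) := hX'.add hY'
  refine ⟨hadd.integrable_sq, ?_⟩
  have hvar := variance_eq_sub hadd
  have hmean : ∫ p, X p.1 + Y p.2 ∂(P.prod Q) = ∫ x, X x ∂P := by
    rw [integral_add (hX'.integrable one_le_two) (hY'.integrable one_le_two),
      integral_fun_fst, integral_fun_snd, hY0]
    simp
  rw [hmean, variance_add_prod hX hY] at hvar
  simp only [Pi.pow_apply] at hvar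
  linarith

/-- The bias-variance decomposition of the error of an affine denoiser. -/
theorem mse_affine (hP : MemLp id 2 P) {lam : Fin n → ℝ}
    {u : OrthonormalBasis (Fin n) ℝ (Vec n)} (hu : IsSortedEigenbasis (covMat P) lam u) (σ : ℝ)
    (L : Vec n →ₗ[ℝ] Vec n) (b : Vec n) :
    mse P σ (fun y => L y + b) = ‖L (meanVec P) + b - meanVec P‖ ^ 2 +
      ∑ i, (lam i * ‖L (u i) - u i‖ ^ 2 + σ ^ 2 * ‖L (u i)‖ ^ 2) := by
  set Ld := LinearMap.adjoint L with hLd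
  set R := L - LinearMap.id with hR
  set Rd := LinearMap.adjoint R with hRd
  have hstd : MemLp id 2 (stdGaussian (Vec n)) := IsGaussian.memLp_two_id
  have hX (k : Fin n) : MemLp (fun x => inner ℝ (Rd (u k)) x + inner ℝ (u k) b) 2 P :=
    (memLp_inner hP _).add (memLp_const _)
  have hY (k : Fin n) : MemLp (fun z => σ * inner ℝ (Ld (u k)) z) 2 (stdGaussian (Vec n)) :=
    (memLp_inner hstd _).const_mul σ
  have hY0 (k : Fin n) : ∫ z, σ * inner ℝ (Ld (u k)) z ∂(stdGaussian (Vec n)) = 0 := by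
    rw [integral_const_mul, integral_inner (f := fun z => z) (hstd.integrable one_le_two)]
    simp
  have hX1 (k : Fin n) : ∫ x, (inner ℝ (Rd (u k)) x + inner ℝ (u k) b) ∂P =
      inner ℝ (u k) (L (meanVec P) + b - meanVec P) := by
    rw [integral_add ((memLp_inner hP _).integrable one_le_two) (integrable_const _),
      integral_inner (f := fun x => x) (hP.integrable one_le_two), integral_const]
    change inner ℝ (Rd (u k)) (meanVec P) + _ = _
    rw [hRd, LinearMap.adjoint_inner_left, hR]
    simp [inner_add_right, inner_sub_right]
    ring
  -- The error is `R x + b + σ L z` with `R = L - I`. Passing to adjoints makes each coordinate a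
  -- function of `x` plus an independent centred function of `z`.
  have hsq (p : Vec n × Vec n) : ‖L (p.1 + σ • p.2) + b - p.1‖ ^ 2 =
      ∑ k, ((inner ℝ (Rd (u k)) p.1 + inner ℝ (u k) b) + σ * inner ℝ (Ld (u k)) p.2) ^ 2 := by
    rw [← u.sum_sq_inner_right]
    refine Finset.sum_congr rfl fun k _ => ?_
    rw [hRd, hLd, LinearMap.adjoint_inner_left, LinearMap.adjoint_inner_left, hR]
    simp [inner_add_right, inner_sub_right, real_inner_smul_right]
    ring
  have hvarX (k : Fin n) : Var[fun x => inner ℝ (Rd (u k)) x + inner ℝ (u k) b; P] =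
      ∑ i, lam i * inner ℝ (R (u i)) (u k) ^ 2 := by
    rw [variance_add_const (memLp_inner hP _).aestronglyMeasurable, variance_inner_eq_sum hP hu]
    simp_rw [hRd, LinearMap.adjoint_inner_right]
  have hvarY (k : Fin n) : Var[fun z => σ * inner ℝ (Ld (u k)) z; stdGaussian (Vec n)] =
      ∑ i, σ ^ 2 * inner ℝ (L (u i)) (u k) ^ 2 := by
    rw [variance_const_mul, variance_inner_stdGaussian, ← u.sum_sq_inner_right, Finset.mul_sum]
    simp_rw [hLd, LinearMap.adjoint_inner_right]
  unfold mse
  simp_rw [hsq]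
  rw [integral_finsetSum _ fun k _ => (integral_add_sq_prod (hX k) (hY k) (hY0 k)).1]
  simp_rw [fun k => (integral_add_sq_prod (hX k) (hY k) (hY0 k)).2, hX1, hvarX, hvarY,
    Finset.sum_add_distrib]
  -- Summing over `k` first collects the coordinates of `R (u i)` and `L (u i)` into their norms.
  rw [u.sum_sq_inner_right, Finset.sum_comm, Finset.sum_comm (f := fun k i => σ ^ 2 * _)]
  simp_rw [← Finset.mul_sum, u.sum_sq_inner_left]
  rw [Finset.mul_sum, add_comm]
  rfl

end MeanSquaredError

/-! ### Minimizers of the error over the bottleneck architectures -/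

section Optimality

variable {n : ℕ}

/-- Functions of the eigenvalues of an operator do not depend on the eigenbasis. -/
theorem diagOp_congr {u v : OrthonormalBasis (Fin n) ℝ (Vec n)} {s f : Fin n → ℝ}
    (h : diagOp v s = diagOp u s) (hf : ∀ i j, s j = s i → f j = f i) :
    diagOp v f = diagOp u f :=
  (diagOp_eq_iff v u f f).2 fun i j hij => hf i j ((diagOp_eq_iff v u s s).1 h i j hij)

/-- After squaring and cross-multiplying, the difference is `x y (y - x) + c (y² - x²)`. Strictness
ensures that whitening neither reorders nor merges eigenvalues. -/
theorem strictMonoOn_div_sqrt_add {c : ℝ} (hc : 0 < c) :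
    StrictMonoOn (fun x : ℝ => x / √(x + c)) (Set.Ici 0) := by
  intro x hx y hy hxy
  rw [Set.mem_Ici] at hx hy
  have hx' : 0 < x + c := by linarith
  have hy' : 0 < y + c := by linarith
  change x / √(x + c) < y / √(y + c)
  rw [div_lt_div_iff₀ (Real.sqrt_pos.2 hx') (Real.sqrt_pos.2 hy')]
  refine lt_of_pow_lt_pow_left₀ 2 (by positivity) ?_
  rw [mul_pow, mul_pow, Real.sq_sqrt hx'.le, Real.sq_sqrt hy'.le]
  have h1 : 0 ≤ x * y * (y - x) := by
    have := sub_nonneg.2 hxy.le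
    positivity
  have h2 : 0 < c * ((y - x) * (y + x)) :=
    mul_pos hc (mul_pos (sub_pos.2 hxy) (by linarith))
  nlinarith

/-- The part of the mean squared error of an affine denoiser that depends on its linear part. -/
noncomputable def linearError (lam : Fin n → ℝ) (u : OrthonormalBasis (Fin n) ℝ (Vec n)) (σ : ℝ)
    (L : Vec n →ₗ[ℝ] Vec n) : ℝ :=
  ∑ i, (lam i * ‖L (u i) - u i‖ ^ 2 + σ ^ 2 * ‖L (u i)‖ ^ 2)

/-- Eigenvalues of the operator that a rescaled linear denoiser has to approximate. -/
noncomputable def whitenedEigenvalue (lam : Fin n → ℝ) (σ : ℝ) (i : Fin n) : ℝ :=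
  lam i / √(lam i + σ ^ 2)

/-- The least value of `linearError` among maps of rank at most `K`. -/
noncomputable def minLinearError (lam : Fin n → ℝ) (σ : ℝ) (K : ℕ) : ℝ :=
  ∑ i, (whitenedEigenvalue lam σ i ^ 2 - truncSeq (fun i => whitenedEigenvalue lam σ i ^ 2) K i) +
    ∑ i, (lam i - lam i ^ 2 / (lam i + σ ^ 2))

variable {lam : Fin n → ℝ} {u v : OrthonormalBasis (Fin n) ℝ (Vec n)} {σ : ℝ} {K : ℕ}

theorem whitenedEigenvalue_nonneg (h0 : ∀ i, 0 ≤ lam i) (i : Fin n) :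
    0 ≤ whitenedEigenvalue lam σ i :=
  div_nonneg (h0 i) (Real.sqrt_nonneg _)

theorem whitenedEigenvalue_antitone (hanti : Antitone lam) (h0 : ∀ i, 0 ≤ lam i) (hσ : 0 < σ) :
    Antitone (whitenedEigenvalue lam σ) := fun _ _ hij =>
  (strictMonoOn_div_sqrt_add (pow_pos hσ 2)).monotoneOn (h0 _) (h0 _) (hanti hij)

/-- Completing the square in each eigendirection: both sides have the quadratic term `(λ + σ²) ‖L
u‖²` and the cross term `-2 λ ⟨L u, u⟩`. -/
theorem linearError_eq (h0 : ∀ i, 0 ≤ lam i) (hσ : 0 < σ) (L : Vec n →ₗ[ℝ] Vec n) :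
    linearError lam u σ L =
      ∑ i, ‖(L ∘ₗ diagOp u fun i => √(lam i + σ ^ 2)) (u i) -
        whitenedEigenvalue lam σ i • u i‖ ^ 2 + ∑ i, (lam i - lam i ^ 2 / (lam i + σ ^ 2)) := by
  rw [linearError, ← Finset.sum_add_distrib]
  refine Finset.sum_congr rfl fun i _ => ?_
  have hpos : 0 < lam i + σ ^ 2 := by have := h0 i; positivity
  have hsq : √(lam i + σ ^ 2) ^ 2 = lam i + σ ^ 2 := Real.sq_sqrt hpos.le
  have hs : √(lam i + σ ^ 2) * whitenedEigenvalue lam σ i = lam i :=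
    mul_div_cancel₀ _ (Real.sqrt_pos.2 hpos).ne'
  have hs2 : whitenedEigenvalue lam σ i ^ 2 = lam i ^ 2 / (lam i + σ ^ 2) := by
    rw [whitenedEigenvalue, div_pow, hsq]
  rw [LinearMap.comp_apply, diagOp_basis, map_smul, norm_sub_sq_real, norm_sub_sq_real, norm_smul,
    norm_smul, real_inner_smul_left, real_inner_smul_right, u.norm_eq_one, mul_pow, mul_pow,
    Real.norm_eq_abs, Real.norm_eq_abs, sq_abs, sq_abs, hsq, ← hs2]
  linear_combination (2 * inner ℝ (L (u i)) (u i)) * hs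

theorem finrank_range_comp_le (L T : Vec n →ₗ[ℝ] Vec n) :
    Module.finrank ℝ (LinearMap.range (L ∘ₗ T)) ≤ Module.finrank ℝ (LinearMap.range L) := by
  refine Submodule.finrank_mono ?_
  rintro _ ⟨x, rfl⟩
  exact ⟨T x, rfl⟩

theorem minLinearError_le (hanti : Antitone lam) (h0 : ∀ i, 0 ≤ lam i) (hσ : 0 < σ)
    (L : Vec n →ₗ[ℝ] Vec n) (hL : Module.finrank ℝ (LinearMap.range L) ≤ K) :
    minLinearError lam σ K ≤ linearError lam u σ L := by
  rw [linearError_eq h0 hσ, minLinearError]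
  refine add_le_add ?_ le_rfl
  exact tail_le_sum_norm_sq_sub u (whitenedEigenvalue_antitone hanti h0 hσ)
    (whitenedEigenvalue_nonneg h0) K _
    ((finrank_range_comp_le L _).trans hL)

theorem diagOp_comp_diagOp (v : OrthonormalBasis (Fin n) ℝ (Vec n)) (f g : Fin n → ℝ) :
    diagOp v f ∘ₗ diagOp v g = diagOp v fun i => g i * f i :=
  v.toBasis.ext fun i => by simp [smul_smul]

/-- `G^(1/2)` is a function of `C`, hence also diagonal in `v`; composing with it turns the
candidate into the truncation of the whitened operator. -/
theorem linearError_truncation (h0 : ∀ i, 0 ≤ lam i) (hσ : 0 < σ)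
    (hv : diagOp v lam = diagOp u lam) :
    linearError lam u σ (diagOp v (truncSeq (fun i => lam i / (lam i + σ ^ 2)) K)) =
      minLinearError lam σ K := by
  rw [linearError_eq h0 hσ, minLinearError]
  congr 1
  have hT : (diagOp v (truncSeq (fun i => lam i / (lam i + σ ^ 2)) K) ∘ₗ
      diagOp u fun i => √(lam i + σ ^ 2)) = diagOp v (truncSeq (whitenedEigenvalue lam σ) K) := by
    rw [← diagOp_congr hv (f := fun i => √(lam i + σ ^ 2)) fun i j hij => by simp only [hij],
      diagOp_comp_diagOp]
    congr 1
    funext i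
    have hpos : 0 < lam i + σ ^ 2 := by have := h0 i; positivity
    unfold truncSeq whitenedEigenvalue
    split_ifs
    · have h1 := (Real.sqrt_pos.2 hpos).ne'
      change √(lam i + σ ^ 2) * (lam i / (lam i + σ ^ 2)) = _
      nth_rewrite 2 [← Real.mul_self_sqrt hpos.le]
      field_simp
    · rw [mul_zero]
  rw [hT]
  exact sum_norm_sq_sub_truncation u v _ K
    (diagOp_congr hv fun i j hij => by simp only [whitenedEigenvalue, hij])

/-- The equality case yields an eigenbasis of the whitened operator. Injectivity of `λ ↦ λ / √(λ +
σ²)` makes it an eigenbasis of `C`, and the positive factor `√(λ + σ²)` is then divided out. -/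
theorem exists_eq_of_linearError_le (hanti : Antitone lam) (h0 : ∀ i, 0 ≤ lam i) (hσ : 0 < σ)
    (L : Vec n →ₗ[ℝ] Vec n) (hL : Module.finrank ℝ (LinearMap.range L) ≤ K)
    (hle : linearError lam u σ L ≤ minLinearError lam σ K) :
    ∃ v : OrthonormalBasis (Fin n) ℝ (Vec n), diagOp v lam = diagOp u lam ∧
      L = diagOp v (truncSeq (fun i => lam i / (lam i + σ ^ 2)) K) := by
  rw [linearError_eq h0 hσ, minLinearError] at hle
  obtain ⟨v, hv, hT⟩ := exists_eq_diagOp_truncSeq u (whitenedEigenvalue_antitone hanti h0 hσ)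
    (whitenedEigenvalue_nonneg h0) K _
    ((finrank_range_comp_le L _).trans hL)
    (le_of_add_le_add_right hle)
  have hlam : diagOp v lam = diagOp u lam := diagOp_congr hv fun i j hij =>
    (strictMonoOn_div_sqrt_add (pow_pos hσ 2)).injOn (h0 j) (h0 i) hij
  refine ⟨v, hlam, v.toBasis.ext fun i => ?_⟩
  rw [← diagOp_congr hlam (f := fun i => √(lam i + σ ^ 2)) fun i j hij => by simp only [hij]] at hT
  have h := LinearMap.congr_fun hT (v i)
  have hpos : 0 < lam i + σ ^ 2 := by have := h0 i; positivity
  have hne := (Real.sqrt_pos.2 hpos).ne'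
  rw [LinearMap.comp_apply, diagOp_basis, diagOp_basis, map_smul] at h
  rw [OrthonormalBasis.coe_toBasis, diagOp_basis]
  rw [← inv_smul_smul₀ hne (L (v i)), h, smul_smul]
  congr 1
  unfold truncSeq whitenedEigenvalue
  split_ifs
  · change _ = lam i / (lam i + σ ^ 2)
    nth_rewrite 3 [← Real.mul_self_sqrt hpos.le]
    field_simp
  · rw [mul_zero]

/-- The `+ 0` presents a linear denoiser as an affine one, so that the same error formula serves
both architectures. -/
theorem mem_linearBottleneck_iff {S : Vec n → Vec n} :
    S ∈ LinearBottleneck n K ↔ ∃ L : Vec n →ₗ[ℝ] Vec n,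
      Module.finrank ℝ (LinearMap.range L) ≤ K ∧ S = fun y => L y + 0 := by
  constructor
  · rintro ⟨A, B, h⟩
    exact ⟨_, finrank_range_mul_le A B, funext fun y => by rw [h, add_zero]; rfl⟩
  · rintro ⟨L, hL, rfl⟩
    obtain ⟨A, B, rfl⟩ := exists_bottleneck_factorization L hL
    exact ⟨A, B, fun y => add_zero _⟩

theorem mem_affineBottleneck_iff {S : Vec n → Vec n} :
    S ∈ AffineBottleneck n K ↔ ∃ (L : Vec n →ₗ[ℝ] Vec n) (b : Vec n),
      Module.finrank ℝ (LinearMap.range L) ≤ K ∧ S = fun y => L y + b := by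
  constructor
  · rintro ⟨A, B, b, h⟩
    exact ⟨_, b, finrank_range_mul_le A B, funext h⟩
  · rintro ⟨L, b, hL, rfl⟩
    obtain ⟨A, B, rfl⟩ := exists_bottleneck_factorization L hL
    exact ⟨A, B, b, fun y => rfl⟩

variable {P : Measure (Vec n)} [IsProbabilityMeasure P]

theorem mse_eq_linearError (hP : MemLp id 2 P) (hu : IsSortedEigenbasis (covMat P) lam u)
    (L : Vec n →ₗ[ℝ] Vec n) (b : Vec n) :
    mse P σ (fun y => L y + b) =
      ‖L (meanVec P) + b - meanVec P‖ ^ 2 + linearError lam u σ L :=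
  mse_affine hP hu σ L b

theorem mse_optimal (hP : MemLp id 2 P) (hu : IsSortedEigenbasis (covMat P) lam u) (hσ : 0 < σ)
    (hv : IsSortedEigenbasis (covMat P) lam v) :
    mse P σ (fun y => meanVec P + act (optimalMap lam v K σ) (y - meanVec P)) =
      minLinearError lam σ K := by
  set L := Matrix.toEuclideanLin (optimalMap lam v K σ) with hL
  have hS : (fun y => meanVec P + act (optimalMap lam v K σ) (y - meanVec P)) =
      fun y => L y + (meanVec P - L (meanVec P)) := by
    funext y
    rw [act_eq_toEuclideanLin, map_sub]
    abel
  rw [hS, mse_eq_linearError hP hu, hL, toEuclideanLin_optimalMap,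
    linearError_truncation (eigenvalues_covMat_nonneg hP hu) hσ
      ((isSortedEigenbasis_iff.1 hv).2.symm.trans (isSortedEigenbasis_iff.1 hu).2)]
  simp

theorem minLinearError_le_mse (hP : MemLp id 2 P) (hu : IsSortedEigenbasis (covMat P) lam u)
    (hσ : 0 < σ) (L : Vec n →ₗ[ℝ] Vec n) (hL : Module.finrank ℝ (LinearMap.range L) ≤ K)
    (b : Vec n) : minLinearError lam σ K ≤ mse P σ (fun y => L y + b) := by
  rw [mse_eq_linearError hP hu]
  have := minLinearError_le (u := u) hu.1 (eigenvalues_covMat_nonneg hP hu) hσ L hL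
  have := sq_nonneg ‖L (meanVec P) + b - meanVec P‖
  linarith

/-- The squared bias and the linear error are bounded below separately, so both bounds are attained:
the second determines the form of `L`, the first then determines `b`. -/
theorem exists_eq_of_mse_le (hP : MemLp id 2 P) (hu : IsSortedEigenbasis (covMat P) lam u)
    (hσ : 0 < σ) (L : Vec n →ₗ[ℝ] Vec n) (hL : Module.finrank ℝ (LinearMap.range L) ≤ K)
    (b : Vec n) (hle : mse P σ (fun y => L y + b) ≤ minLinearError lam σ K) :
    ∃ v : OrthonormalBasis (Fin n) ℝ (Vec n), IsSortedEigenbasis (covMat P) lam v ∧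
      ∀ y, L y + b = meanVec P + act (optimalMap lam v K σ) (y - meanVec P) := by
  rw [mse_eq_linearError hP hu] at hle
  have h0 := eigenvalues_covMat_nonneg hP hu
  have hmin := minLinearError_le (u := u) hu.1 h0 hσ L hL
  have hsq := sq_nonneg ‖L (meanVec P) + b - meanVec P‖
  obtain ⟨v, hv, hLv⟩ := exists_eq_of_linearError_le hu.1 h0 hσ L hL (by linarith)
  refine ⟨v, isSortedEigenbasis_iff.2 ⟨hu.1, (isSortedEigenbasis_iff.1 hu).2.trans hv.symm⟩,
    fun y => ?_⟩
  have hb : L (meanVec P) + b - meanVec P = 0 :=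
    norm_eq_zero.1 ((pow_eq_zero_iff two_ne_zero).1 (by linarith))
  rw [act_eq_toEuclideanLin, toEuclideanLin_optimalMap, ← hLv, map_sub]
  rw [← sub_eq_zero, ← hb]
  abel

theorem optimal_mem_affineBottleneck (v : OrthonormalBasis (Fin n) ℝ (Vec n)) (m : Vec n) :
    (fun y => m + act (optimalMap lam v K σ) (y - m)) ∈ AffineBottleneck n K := by
  refine mem_affineBottleneck_iff.2 ⟨Matrix.toEuclideanLin (optimalMap lam v K σ),
    m - Matrix.toEuclideanLin (optimalMap lam v K σ) m, ?_, funext fun y => ?_⟩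
  · rw [toEuclideanLin_optimalMap]
    exact finrank_range_diagOp_truncSeq_le _ _ _
  · rw [act_eq_toEuclideanLin, map_sub]
    abel

theorem optimal_mem_linearBottleneck (v : OrthonormalBasis (Fin n) ℝ (Vec n)) :
    (fun y => act (optimalMap lam v K σ) y) ∈ LinearBottleneck n K := by
  refine mem_linearBottleneck_iff.2 ⟨Matrix.toEuclideanLin (optimalMap lam v K σ), ?_,
    funext fun y => (add_zero _).symm⟩
  rw [toEuclideanLin_optimalMap]
  exact finrank_range_diagOp_truncSeq_le _ _ _

/-- The optimal denoisers with bottleneck and bias. -/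
theorem isMSEOptimal_affineBottleneck_iff (hP : MemLp id 2 P)
    (hu : IsSortedEigenbasis (covMat P) lam u) (hσ : 0 < σ) (S : Vec n → Vec n) :
    IsMSEOptimal P (AffineBottleneck n K) σ S ↔
      ∃ v : OrthonormalBasis (Fin n) ℝ (Vec n), IsSortedEigenbasis (covMat P) lam v ∧
        ∀ y, S y = meanVec P + act (optimalMap lam v K σ) (y - meanVec P) := by
  constructor
  · rintro ⟨hS, hmin⟩
    obtain ⟨L, b, hL, rfl⟩ := mem_affineBottleneck_iff.1 hS
    exact exists_eq_of_mse_le hP hu hσ L hL b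
      ((hmin _ (optimal_mem_affineBottleneck u (meanVec P))).trans_eq (mse_optimal hP hu hσ hu))
  · rintro ⟨v, hv, hS⟩
    rw [funext hS]
    refine ⟨optimal_mem_affineBottleneck v _, fun S' hS' => ?_⟩
    obtain ⟨L, b, hL, rfl⟩ := mem_affineBottleneck_iff.1 hS'
    rw [mse_optimal hP hu hσ hv]
    exact minLinearError_le_mse hP hu hσ L hL b

/-- The optimal denoisers with bottleneck for a centred target. -/
theorem isMSEOptimal_linearBottleneck_iff (hP : MemLp id 2 P)
    (hu : IsSortedEigenbasis (covMat P) lam u) (hmean : meanVec P = 0) (hσ : 0 < σ)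
    (S : Vec n → Vec n) :
    IsMSEOptimal P (LinearBottleneck n K) σ S ↔
      ∃ v : OrthonormalBasis (Fin n) ℝ (Vec n), IsSortedEigenbasis (covMat P) lam v ∧
        ∀ y, S y = act (optimalMap lam v K σ) y := by
  have hopt (v) (hv : IsSortedEigenbasis (covMat P) lam v) :
      mse P σ (fun y => act (optimalMap lam v K σ) y) = minLinearError lam σ K := by
    simpa [hmean] using mse_optimal (K := K) hP hu hσ hv
  constructor
  · rintro ⟨hS, hmin⟩
    obtain ⟨L, hL, rfl⟩ := mem_linearBottleneck_iff.1 hS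
    simpa [hmean] using exists_eq_of_mse_le hP hu hσ L hL 0
      ((hmin _ (optimal_mem_linearBottleneck u)).trans_eq (hopt u hu))
  · rintro ⟨v, hv, hS⟩
    rw [funext hS]
    refine ⟨optimal_mem_linearBottleneck v, fun S' hS' => ?_⟩
    obtain ⟨L, hL, rfl⟩ := mem_linearBottleneck_iff.1 hS'
    rw [hopt v hv]
    exact minLinearError_le_mse hP hu hσ L hL 0

/-- Under a spectral gap the optimal map does not depend on the eigenbasis. -/
theorem act_optimalMap_eq_of_hasSpectralGap {C : Matrix (Fin n) (Fin n) ℝ}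
    (hu : IsSortedEigenbasis C lam u) (hv : IsSortedEigenbasis C lam v)
    (hgap : HasSpectralGap lam K) (y : Vec n) :
    act (optimalMap lam v K σ) y = act (optimalMap lam u K σ) y := by
  rw [act_eq_toEuclideanLin, act_eq_toEuclideanLin, toEuclideanLin_optimalMap,
    toEuclideanLin_optimalMap]
  have huv := (isSortedEigenbasis_iff.1 hv).2.symm.trans (isSortedEigenbasis_iff.1 hu).2
  rw [diagOp_congr huv]
  -- Equal eigenvalues must receive equal truncated coefficients. A tie across the cut can only
  -- occur at eigenvalue zero, where the coefficient vanishes anyway.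
  intro i j hij
  unfold truncSeq
  split_ifs with h1 h2 h2
  · simp only [hij]
  · rcases hgap j i h1 (not_lt.1 h2) with h | h
    · exact absurd hij h.ne'
    · simp only [hij, h, zero_div]
  · rcases hgap i j h2 (not_lt.1 h1) with h | h
    · exact absurd hij h.ne
    · simp only [← hij, h, zero_div]
  · rfl

end Optimality

/-! ### The scalar variance recursion along one eigendirection -/

section OneDimensional

/-- Factor by which one sampling step scales a coordinate along which the target variance is `l`. -/
noncomputable def stepFactor (l η a b : ℝ) : ℝ :=
  (l + √(b ^ 2 - injected η a b ^ 2) * a) / (l + a ^ 2)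

/-- Total factor by which `j` sampling steps scale a coordinate. -/
noncomputable def totalFactor (l η : ℝ) (s : ℕ → ℝ) : ℕ → ℝ
  | 0 => 1
  | j + 1 => stepFactor l η (s j) (s (j + 1)) * totalFactor l η s j

/-- Variance of a coordinate after `j` sampling steps. -/
noncomputable def sampleVariance (l η : ℝ) (s : ℕ → ℝ) : ℕ → ℝ
  | 0 => s 0 ^ 2
  | j + 1 => stepFactor l η (s j) (s (j + 1)) ^ 2 * sampleVariance l η s j +
      injected η (s j) (s (j + 1)) ^ 2

theorem sampleVariance_nonneg (l η : ℝ) (s : ℕ → ℝ) (j : ℕ) : 0 ≤ sampleVariance l η s j := by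
  induction j with
  | zero => exact sq_nonneg _
  | succ j ih => rw [sampleVariance]; positivity

variable {l η a b : ℝ}

theorem injected_sq_le (hη : η ∈ Set.Icc (0 : ℝ) 1) (hb : 0 ≤ b) (hba : b < a) :
    injected η a b ^ 2 ≤ b ^ 2 * (1 - b ^ 2 / a ^ 2) := by
  have ha : 0 < a := hb.trans_lt hba
  have h1 : 0 ≤ 1 - b ^ 2 / a ^ 2 := by
    rw [sub_nonneg, div_le_one (by positivity)]
    exact pow_le_pow_left₀ hb hba.le 2
  rw [injected, mul_pow, mul_pow, Real.sq_sqrt h1, mul_assoc]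
  exact mul_le_of_le_one_left (by positivity) (pow_le_one₀ hη.1 hη.2)

/-- The noise is largest at `η = 1`, where `√(b² - τ²) = b² / a`. With the upper bound `b`, this
brackets the root uniformly in `η`. -/
theorem sq_div_le_sqrt_sub (hη : η ∈ Set.Icc (0 : ℝ) 1) (hb : 0 ≤ b) (hba : b < a) :
    b ^ 2 ≤ √(b ^ 2 - injected η a b ^ 2) * a := by
  have ha : 0 < a := hb.trans_lt hba
  rw [← div_le_iff₀ ha]
  refine Real.le_sqrt_of_sq_le ?_
  have h := injected_sq_le hη hb hba
  have : (b ^ 2 / a) ^ 2 = b ^ 2 * (b ^ 2 / a ^ 2) := by ring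
  rw [this]
  linarith

theorem sq_sqrt_sub_injected (hη : η ∈ Set.Icc (0 : ℝ) 1) (hb : 0 ≤ b) (hba : b < a) :
    √(b ^ 2 - injected η a b ^ 2) ^ 2 = b ^ 2 - injected η a b ^ 2 := by
  refine Real.sq_sqrt ?_
  have h := injected_sq_le hη hb hba
  have : 0 ≤ b ^ 2 * (b ^ 2 / a ^ 2) := by positivity
  linarith

theorem sqrt_sub_injected_le (hb : 0 ≤ b) : √(b ^ 2 - injected η a b ^ 2) ≤ b :=
  Real.sqrt_le_iff.2 ⟨hb, sub_le_self _ (sq_nonneg _)⟩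

/-- Since the root is at most `b`, Cauchy-Schwarz gives `(l + b a)² ≤ (l + b²) (l + a²)`. The
resulting ratio telescopes along a schedule. -/
theorem stepFactor_sq_le (hl : 0 ≤ l) (hb : 0 ≤ b) (hba : b < a) :
    stepFactor l η a b ^ 2 ≤ (l + b ^ 2) / (l + a ^ 2) := by
  have ha : 0 < a := hb.trans_lt hba
  have hpos : 0 < l + a ^ 2 := by positivity
  rw [stepFactor, div_pow, div_le_div_iff₀ (by positivity) hpos]
  set c := √(b ^ 2 - injected η a b ^ 2)
  have hc0 : 0 ≤ c := Real.sqrt_nonneg _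
  have hcb : c ≤ b := sqrt_sub_injected_le hb
  have h1 : (l + c * a) ^ 2 ≤ (l + b * a) ^ 2 := by gcongr
  have h2 : (l + b * a) ^ 2 ≤ (l + b ^ 2) * (l + a ^ 2) := by
    nlinarith [mul_nonneg hl (sq_nonneg (a - b))]
  calc (l + c * a) ^ 2 * (l + a ^ 2) ≤ (l + b ^ 2) * (l + a ^ 2) * (l + a ^ 2) := by
        gcongr; exact h1.trans h2
    _ = _ := by ring

theorem stepFactor_sq_le_one (hl : 0 ≤ l) (hb : 0 ≤ b) (hba : b < a) :
    stepFactor l η a b ^ 2 ≤ 1 := by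
  have ha : 0 < a := hb.trans_lt hba
  refine (stepFactor_sq_le hl hb hba).trans ((div_le_one (by positivity)).2 ?_)
  have := pow_le_pow_left₀ hb hba.le 2
  linarith

/-- The exact one-step recursion for the deviation of the variance from `l + σ²`. -/
theorem variance_step_eq (hη : η ∈ Set.Icc (0 : ℝ) 1) (hl : 0 ≤ l) (hb : 0 ≤ b) (hba : b < a)
    (V : ℝ) :
    stepFactor l η a b ^ 2 * V + injected η a b ^ 2 - (l + b ^ 2) =
      stepFactor l η a b ^ 2 * (V - (l + a ^ 2)) -
        l * (a - √(b ^ 2 - injected η a b ^ 2)) ^ 2 / (l + a ^ 2) := by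
  have ha : 0 < a := hb.trans_lt hba
  have hpos : l + a ^ 2 ≠ 0 := by positivity
  have hc := sq_sqrt_sub_injected hη hb hba
  set c := √(b ^ 2 - injected η a b ^ 2) with hcdef
  have hτ : injected η a b ^ 2 = b ^ 2 - c ^ 2 := by linarith
  -- The identity behind this is `(l + c a)² = (l + c²) (l + a²) - l (a - c)²`.
  rw [hτ, stepFactor, ← hcdef]
  field_simp
  ring

/-- From `b² / a ≤ c ≤ b` follows `a - c ≤ 2 (a - b)`, so the error is of second order. One factor
`a - b` becomes `δ`; the other is absorbed into a difference of `√l / (√l + ·)`, so that the sum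
over all steps telescopes. -/
theorem local_error_le (hη : η ∈ Set.Icc (0 : ℝ) 1) (hl : 0 ≤ l) (hb : 0 ≤ b) (hba : b < a)
    {δ : ℝ} (hδ : a - b ≤ δ) :
    l * (a - √(b ^ 2 - injected η a b ^ 2)) ^ 2 / (l + a ^ 2) ≤
      8 * δ * √l * (√l / (√l + b) - √l / (√l + a)) := by
  have ha : 0 < a := hb.trans_lt hba
  have hca := sq_div_le_sqrt_sub hη hb hba
  have hcb : √(b ^ 2 - injected η a b ^ 2) ≤ b := sqrt_sub_injected_le hb
  set c := √(b ^ 2 - injected η a b ^ 2)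
  rcases hl.eq_or_lt with rfl | hl'
  · simp
  set r := √l with hr
  have hr0 : 0 < r := Real.sqrt_pos.2 hl'
  have hlr : l = r ^ 2 := (Real.sq_sqrt hl).symm
  have hab : 0 < a - b := sub_pos.2 hba
  have h1 : a - c ≤ 2 * (a - b) := by
    have h : (a - c) * a ≤ 2 * (a - b) * a := by nlinarith
    exact le_of_mul_le_mul_right h ha
  have h2 : (a - c) ^ 2 ≤ 4 * δ * (a - b) := by
    have h0 : 0 ≤ a - c := by linarith
    calc (a - c) ^ 2 ≤ (2 * (a - b)) ^ 2 := by gcongr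
      _ = 4 * (a - b) * (a - b) := by ring
      _ ≤ 4 * δ * (a - b) := by gcongr
  have h3 : r / (r + b) - r / (r + a) = r * (a - b) / ((r + b) * (r + a)) := by
    field_simp
    ring
  have h4 : (r + b) * (r + a) ≤ 2 * (r ^ 2 + a ^ 2) := by
    nlinarith [sq_nonneg (r - a)]
  rw [h3, hlr, div_le_iff₀ (by positivity)]
  have hδ0 : 0 < δ := hab.trans_le hδ
  calc r ^ 2 * (a - c) ^ 2 ≤ r ^ 2 * (4 * δ * (a - b)) := by gcongr
    _ = 4 * δ * r * (r * (a - b) / ((r + b) * (r + a))) * ((r + b) * (r + a)) := by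
        field_simp
    _ ≤ 4 * δ * r * (r * (a - b) / ((r + b) * (r + a))) * (2 * (r ^ 2 + a ^ 2)) := by
        gcongr
    _ = _ := by ring

theorem NoiseSchedule.level_pos (s : NoiseSchedule) {j : ℕ} (hj : j < s.steps) :
    0 < s.level j := by
  have key : ∀ k j, s.steps = j + k + 1 → 0 < s.level j := by
    intro k
    induction k with
    | zero =>
      intro j h
      have h1 := s.decreasing j (by omega)
      have h2 := s.last
      rw [h] at h2
      simpa [h2] using h1
    | succ k ih =>
      intro j h
      exact (ih (j + 1) (by omega)).trans (s.decreasing j (by omega))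
  exact key (s.steps - j - 1) j (by omega)

theorem NoiseSchedule.level_nonneg (s : NoiseSchedule) {j : ℕ} (hj : j ≤ s.steps) :
    0 ≤ s.level j := by
  rcases hj.lt_or_eq with h | rfl
  · exact (s.level_pos h).le
  · exact s.last.ge

theorem totalFactor_sq_le (s : NoiseSchedule) (hl : 0 ≤ l) (h0 : 0 < s.level 0) {j : ℕ}
    (hj : j ≤ s.steps) :
    totalFactor l η s.level j ^ 2 ≤ (l + s.level j ^ 2) / (l + s.level 0 ^ 2) := by
  induction j with
  | zero => rw [totalFactor, div_self (by positivity), one_pow]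
  | succ j ih =>
    have hpos := s.level_pos hj
    have hden : 0 < l + s.level j ^ 2 := by positivity
    rw [totalFactor, mul_pow]
    calc _ ≤ (l + s.level (j + 1) ^ 2) / (l + s.level j ^ 2) *
          ((l + s.level j ^ 2) / (l + s.level 0 ^ 2)) :=
          mul_le_mul (stepFactor_sq_le hl (s.level_nonneg hj) (s.decreasing j hj))
            (ih (Nat.le_of_succ_le hj)) (sq_nonneg _) (by positivity)
      _ = _ := by field_simp

/-- The first term is the initial deviation `l` after contraction. In the second, the contraction is
discarded and the local errors are summed by telescoping. -/
theorem abs_sampleVariance_sub_le (s : NoiseSchedule) (hη : η ∈ Set.Icc (0 : ℝ) 1) (hl : 0 ≤ l)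
    {δ : ℝ} (hδ : ∀ j < s.steps, s.level j - s.level (j + 1) ≤ δ) {j : ℕ} (hj : j ≤ s.steps) :
    |sampleVariance l η s.level j - (l + s.level j ^ 2)| ≤ totalFactor l η s.level j ^ 2 * l +
      8 * δ * √l * (√l / (√l + s.level j) - √l / (√l + s.level 0)) := by
  induction j with
  | zero =>
    rw [sampleVariance, totalFactor]
    simp [abs_of_nonneg hl]
  | succ j ih =>
    have hpos := s.level_pos hj
    have hb := s.level_nonneg hj
    have hba := s.decreasing j hj
    have hloc := local_error_le hη hl hb hba (hδ j hj)
    have hloc0 : 0 ≤ l * (s.level j - √(s.level (j + 1) ^ 2 -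
        injected η (s.level j) (s.level (j + 1)) ^ 2)) ^ 2 / (l + s.level j ^ 2) := by positivity
    have h1 := stepFactor_sq_le_one (η := η) hl hb hba
    have ih' := ih (Nat.le_of_succ_le hj)
    rw [sampleVariance, variance_step_eq hη hl hb hba, totalFactor]
    set ρ := stepFactor l η (s.level j) (s.level (j + 1))
    set e := sampleVariance l η s.level j - (l + s.level j ^ 2)
    have hg : 0 ≤ 8 * δ * √l * (√l / (√l + s.level j) - √l / (√l + s.level 0)) := by
      rcases hl.eq_or_lt with rfl | hl'
      · simp
      have hr0 : 0 < √l := Real.sqrt_pos.2 hl'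
      have hδ0 : 0 < δ := (sub_pos.2 hba).trans_le (hδ j hj)
      have hle : s.level j ≤ s.level 0 := by
        have : ∀ i ≤ s.steps, s.level i ≤ s.level 0 := by
          intro i hi
          induction i with
          | zero => exact le_rfl
          | succ i ihi => exact (s.decreasing i hi).le.trans (ihi (Nat.le_of_succ_le hi))
        exact this j (Nat.le_of_succ_le hj)
      have : √l / (√l + s.level 0) ≤ √l / (√l + s.level j) := by gcongr
      exact mul_nonneg (by positivity) (sub_nonneg.2 this)
    calc |ρ ^ 2 * e - _| ≤ |ρ ^ 2 * e| + |_| := abs_sub _ _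
      _ = ρ ^ 2 * |e| + _ := by rw [abs_mul, abs_of_nonneg (sq_nonneg ρ), abs_of_nonneg hloc0]
      _ ≤ ρ ^ 2 * (totalFactor l η s.level j ^ 2 * l +
            8 * δ * √l * (√l / (√l + s.level j) - √l / (√l + s.level 0))) +
          8 * δ * √l * (√l / (√l + s.level (j + 1)) - √l / (√l + s.level j)) := by gcongr
      _ ≤ ρ ^ 2 * (totalFactor l η s.level j ^ 2 * l) +
            8 * δ * √l * (√l / (√l + s.level j) - √l / (√l + s.level 0)) +
          8 * δ * √l * (√l / (√l + s.level (j + 1)) - √l / (√l + s.level j)) := by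
          linarith [mul_le_of_le_one_left hg h1, mul_add (ρ ^ 2) (totalFactor l η s.level j ^ 2 * l)
            (8 * δ * √l * (√l / (√l + s.level j) - √l / (√l + s.level 0)))]
      _ = _ := by ring

variable {s : ℕ → NoiseSchedule}

theorem tendsto_div_add_level_sq (h0 : Tendsto (fun m => (s m).level 0) atTop atTop) (c l : ℝ) :
    Tendsto (fun m => c / (l + (s m).level 0 ^ 2)) atTop (𝓝 0) :=
  Tendsto.const_div_atTop (tendsto_atTop_add_const_left _ _
    ((tendsto_pow_atTop two_ne_zero).comp h0)) c

theorem tendsto_totalFactor (hl : 0 ≤ l) (h0 : Tendsto (fun m => (s m).level 0) atTop atTop) :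
    Tendsto (fun m => totalFactor l η (s m).level (s m).steps) atTop (𝓝 0) := by
  have hsq : Tendsto (fun m => totalFactor l η (s m).level (s m).steps ^ 2) atTop (𝓝 0) := by
    refine squeeze_zero' (Eventually.of_forall fun m => sq_nonneg _) ?_
      (tendsto_div_add_level_sq h0 l l)
    filter_upwards [h0.eventually_gt_atTop 0] with m hm
    have h := totalFactor_sq_le (η := η) (s m) hl hm le_rfl
    rwa [(s m).last, zero_pow two_ne_zero, add_zero] at h
  have h := hsq.sqrt
  simp only [Real.sqrt_sq_eq_abs, Real.sqrt_zero] at h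
  exact (tendsto_zero_iff_abs_tendsto_zero _).2 h

theorem tendsto_sampleVariance (hη : η ∈ Set.Icc (0 : ℝ) 1) (hl : 0 ≤ l)
    (h0 : Tendsto (fun m => (s m).level 0) atTop atTop)
    (hstep : ∀ δ : ℝ, 0 < δ → ∀ᶠ m in atTop,
      ∀ j < (s m).steps, (s m).level j - (s m).level (j + 1) ≤ δ) :
    Tendsto (fun m => sampleVariance l η (s m).level (s m).steps) atTop (𝓝 l) := by
  have hsq := ((tendsto_totalFactor (η := η) hl h0).pow 2).mul_const l
  rw [zero_pow two_ne_zero, zero_mul] at hsq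
  rw [Metric.tendsto_nhds]
  intro ε hε
  -- Chosen so that `8 δ √l ≤ ε / 2`; the `+ 1` covers `l = 0`.
  have hδ : 0 < ε / (16 * (√l + 1)) := by positivity
  filter_upwards [hstep _ hδ, hsq.eventually_lt_const (half_pos hε),
    h0.eventually_gt_atTop 0] with m hm hm' hm0
  have h := abs_sampleVariance_sub_le (s m) hη hl hm le_rfl
  rw [(s m).last, zero_pow two_ne_zero, add_zero, add_zero] at h
  rw [Real.dist_eq]
  have h1 : √l / √l - √l / (√l + (s m).level 0) ≤ 1 := by
    have : 0 ≤ √l / (√l + (s m).level 0) := by positivity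
    have := div_self_le_one √l
    linarith
  have h2 : 8 * (ε / (16 * (√l + 1))) * √l * (√l / √l - √l / (√l + (s m).level 0)) ≤ ε / 2 := by
    calc _ ≤ 8 * (ε / (16 * (√l + 1))) * √l * 1 := by gcongr
      _ = ε / 2 * (√l / (√l + 1)) := by field_simp; ring
      _ ≤ ε / 2 * 1 := by
          gcongr
          exact (div_le_one (by positivity)).2 (by linarith)
      _ = ε / 2 := mul_one _
  linarith

end OneDimensional

/-! ### Gaussian laws of the sampler and their weak limit -/

section Sampler

variable {n : ℕ} {u : OrthonormalBasis (Fin n) ℝ (Vec n)}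

theorem measurable_diagOp (f : Fin n → ℝ) : Measurable (diagOp u f) :=
  (LinearMap.continuous_of_finiteDimensional _).measurable

theorem norm_sq_diagOp (f : Fin n → ℝ) (t : Vec n) :
    ‖diagOp u f t‖ ^ 2 = ∑ i, f i ^ 2 * inner ℝ (u i) t ^ 2 := by
  rw [← u.sum_sq_inner_right]
  simp_rw [inner_diagOp, mul_pow]

/-- The Gaussian law with mean `c` and covariance `∑ f_i² u_i u_iᵀ`. -/
theorem charFun_map_diagOp (c : Vec n) (f : Fin n → ℝ) (t : Vec n) :
    charFun ((stdGaussian (Vec n)).map fun z => c + diagOp u f z) t =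
      Complex.exp (inner ℝ c t * Complex.I) *
        Complex.exp (-(∑ i, f i ^ 2 * inner ℝ (u i) t ^ 2 : ℝ) / 2) := by
  have hm : Measurable fun z => c + diagOp u f z := (measurable_diagOp f).const_add c
  rw [charFun_apply, integral_map hm.aemeasurable (by fun_prop)]
  have h := charFun_stdGaussian (diagOp u f t)
  rw [charFun_apply, ← Complex.ofReal_pow, norm_sq_diagOp] at h
  rw [← h, ← integral_const_mul]
  refine integral_congr_ae (Eventually.of_forall fun z => ?_)
  simp only
  rw [← Complex.exp_add, inner_add_left, diagOp_isSymmetric u f z t]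
  push_cast
  ring_nf

/-- The sum of two independent Gaussian vectors that are diagonal in the same basis. -/
theorem map_prod_diagOp_add_smul (c : Vec n) (f h : Fin n → ℝ) (τ : ℝ)
    (hh : ∀ i, h i ^ 2 = f i ^ 2 + τ ^ 2) :
    ((stdGaussian (Vec n)).prod (stdGaussian (Vec n))).map
        (fun p => c + diagOp u f p.1 + τ • p.2) =
      (stdGaussian (Vec n)).map fun z => c + diagOp u h z := by
  have hmf : Measurable fun z => c + diagOp u f z := (measurable_diagOp f).const_add c
  have hmh : Measurable fun z => c + diagOp u h z := (measurable_diagOp h).const_add c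
  have hmp : Measurable fun p : Vec n × Vec n => c + diagOp u f p.1 + τ • p.2 :=
    (hmf.comp measurable_fst).add (measurable_snd.const_smul τ)
  have := Measure.isProbabilityMeasure_map (μ := stdGaussian (Vec n)) hmh.aemeasurable
  have := Measure.isProbabilityMeasure_map
    (μ := (stdGaussian (Vec n)).prod (stdGaussian (Vec n))) hmp.aemeasurable
  refine Measure.ext_of_charFun (funext fun t => ?_)
  have hf := charFun_map_diagOp (u := u) c f t
  have hτ := charFun_stdGaussian (τ • t)
  rw [charFun_apply, integral_map hmf.aemeasurable (by fun_prop)] at hf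
  rw [charFun_apply] at hτ
  rw [charFun_map_diagOp, charFun_apply, integral_map hmp.aemeasurable (by fun_prop)]
  have hsplit (p : Vec n × Vec n) :
      Complex.exp (inner ℝ (c + diagOp u f p.1 + τ • p.2) t * Complex.I) =
        Complex.exp (inner ℝ (c + diagOp u f p.1) t * Complex.I) *
          Complex.exp (inner ℝ p.2 (τ • t) * Complex.I) := by
    rw [← Complex.exp_add, inner_add_left, real_inner_smul_left, real_inner_smul_right]
    push_cast
    ring_nf
  simp_rw [hsplit]
  rw [integral_prod_mul (fun x => Complex.exp (inner ℝ (c + diagOp u f x) t * Complex.I))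
    (fun z => Complex.exp (inner ℝ z (τ • t) * Complex.I)), hf, hτ, mul_assoc, ← Complex.exp_add]
  congr 2
  simp_rw [hh, add_mul, Finset.sum_add_distrib]
  rw [← Finset.mul_sum, u.sum_sq_inner_right, norm_smul, ← Complex.ofReal_pow, mul_pow,
    Real.norm_eq_abs, sq_abs]
  push_cast
  ring

theorem posSemidef_eigenTrunc {lam : Fin n → ℝ} (h0 : ∀ i, 0 ≤ lam i) (K : ℕ) :
    (eigenTrunc lam u K).PosSemidef := by
  refine Matrix.posSemidef_sum _ fun i _ => ?_
  exact (by simpa using Matrix.posSemidef_vecMulVec_self_star (u i).ofLp :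
    (Matrix.vecMulVec (u i).ofLp (u i).ofLp).PosSemidef).smul (h0 i)

/-- Presents the target as an image of the same standard Gaussian as the sampler laws, which reduces
weak convergence to convergence of coefficients. -/
theorem multivariateGaussian_eigenTrunc (m : Vec n) {lam : Fin n → ℝ} (h0 : ∀ i, 0 ≤ lam i)
    (K : ℕ) : multivariateGaussian m (eigenTrunc lam u K) =
      (stdGaussian (Vec n)).map fun z => m + diagOp u (fun i => √(truncSeq lam K i)) z := by
  have hm : Measurable fun z => m + diagOp u (fun i => √(truncSeq lam K i)) z :=
    (measurable_diagOp _).const_add m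
  have := Measure.isProbabilityMeasure_map (μ := stdGaussian (Vec n)) hm.aemeasurable
  refine Measure.ext_of_charFun (funext fun t => ?_)
  rw [charFun_multivariateGaussian (posSemidef_eigenTrunc h0 K), charFun_map_diagOp,
    ← Complex.exp_add]
  have hq : (t.ofLp ⬝ᵥ (eigenTrunc lam u K).mulVec t.ofLp) =
      ∑ i, √(truncSeq lam K i) ^ 2 * inner ℝ (u i) t ^ 2 := by
    have h1 : (t.ofLp ⬝ᵥ (eigenTrunc lam u K).mulVec t.ofLp) =
        inner ℝ t (Matrix.toEuclideanLin (eigenTrunc lam u K) t) := by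
      simp [PiLp.inner_apply, dotProduct, Matrix.toLpLin_apply, mul_comm]
    rw [h1, toEuclideanLin_eigenTrunc, inner_diagOp_self]
    refine Finset.sum_congr rfl fun i _ => ?_
    rw [Real.sq_sqrt]
    unfold truncSeq
    split_ifs
    exacts [h0 i, le_rfl]
  rw [hq, real_inner_comm]
  ring_nf

/-- One sampling step of the optimal denoiser contracts each eigendirection and adds noise. -/
theorem step_optimal {S : ℝ → Vec n → Vec n} {m : Vec n} {lam : Fin n → ℝ} {K : ℕ}
    (h0 : ∀ i, 0 ≤ lam i)
    (hS : ∀ σ : ℝ, 0 < σ → ∀ y, S σ y = m + act (optimalMap lam u K σ) (y - m))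
    (η : ℝ) {a : ℝ} (ha : 0 < a) (b : ℝ) (y z : Vec n) :
    step S η a b y z = m + diagOp u (fun i => stepFactor (truncSeq lam K i) η a b) (y - m) +
      injected η a b • z := by
  rw [step, hS a ha, act_eq_toEuclideanLin, toEuclideanLin_optimalMap]
  congr 1
  rw [add_assoc]
  congr 1
  set w := y - m with hw
  have hy : y - (m + diagOp u (truncSeq (fun i => lam i / (lam i + a ^ 2)) K) w) =
      w - diagOp u (truncSeq (fun i => lam i / (lam i + a ^ 2)) K) w := by rw [hw]; abel
  rw [hy]
  refine u.repr.injective (PiLp.ext fun i => ?_)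
  simp only [u.repr_apply_apply, inner_add_right, real_inner_smul_right, inner_sub_right,
    inner_diagOp]
  have hden : lam i + a ^ 2 ≠ 0 := by have := h0 i; positivity
  -- With `c` the root in the step, the factor is `g + (c / a) (1 - g)`, where `g` is `λ / (λ + a²)`
  -- on retained coordinates and `0` on the others, matching `l = λ` and `l = 0`.
  unfold stepFactor truncSeq
  split_ifs
  · field_simp
    ring
  · field_simp
    ring

/-- The law of the sampler is Gaussian, diagonal in the eigenbasis. -/
theorem samplerLaw_eq {S : ℝ → Vec n → Vec n} {m : Vec n} {lam : Fin n → ℝ} {K : ℕ}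
    (h0 : ∀ i, 0 ≤ lam i)
    (hS : ∀ σ : ℝ, 0 < σ → ∀ y, S σ y = m + act (optimalMap lam u K σ) (y - m))
    (η : ℝ) (s : NoiseSchedule) (hs : 0 ≤ s.level 0) {j : ℕ} (hj : j ≤ s.steps) :
    samplerLaw S η s.level j = (stdGaussian (Vec n)).map fun z =>
      (m - diagOp u (fun i => totalFactor (truncSeq lam K i) η s.level j) m) +
        diagOp u (fun i => √(sampleVariance (truncSeq lam K i) η s.level j)) z := by
  induction j with
  | zero =>
    rw [samplerLaw]
    congr 1
    funext z
    refine u.repr.injective (PiLp.ext fun i => ?_)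
    simp only [u.repr_apply_apply, inner_add_right, real_inner_smul_right, inner_sub_right,
      inner_diagOp, totalFactor, sampleVariance, Real.sqrt_sq hs]
    ring
  | succ j ih =>
    have hm (c : Vec n) (f : Fin n → ℝ) : Measurable fun z => c + diagOp u f z :=
      (measurable_diagOp f).const_add c
    rw [samplerLaw, ih (Nat.le_of_succ_le hj)]
    simp_rw [step_optimal h0 hS η (s.level_pos hj)]
    set A := fun i => totalFactor (truncSeq lam K i) η s.level j with hA
    set V := fun i => √(sampleVariance (truncSeq lam K i) η s.level j) with hV
    set ρ := fun i => stepFactor (truncSeq lam K i) η (s.level j) (s.level (j + 1)) with hρ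
    set τ := injected η (s.level j) (s.level (j + 1)) with hτ
    -- The new coordinate is a sum of independent Gaussians with standard deviations `|V i * ρ i|`
    -- and `|τ|`; only their squares enter.
    rw [← map_prod_diagOp_add_smul
      (m - diagOp u (fun i => totalFactor (truncSeq lam K i) η s.level (j + 1)) m)
      (fun i => V i * ρ i)
      (fun i => √(sampleVariance (truncSeq lam K i) η s.level (j + 1))) τ]
    · have hmp : Measurable fun p : Vec n × Vec n => m + diagOp u ρ (p.1 - m) + τ • p.2 :=
        (((measurable_diagOp ρ).comp (measurable_fst.sub_const m)).const_add m).add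
          (measurable_snd.const_smul τ)
      have hprod : ((stdGaussian (Vec n)).map fun z => m - diagOp u A m + diagOp u V z).prod
          (stdGaussian (Vec n)) = ((stdGaussian (Vec n)).prod (stdGaussian (Vec n))).map
            (Prod.map (fun z => m - diagOp u A m + diagOp u V z) id) := by
        rw [← Measure.map_prod_map _ _ (hm _ _) measurable_id, Measure.map_id]
      rw [hprod, Measure.map_map hmp ((hm _ _).prodMap measurable_id)]
      congr 1
      funext p
      refine u.repr.injective (PiLp.ext fun i => ?_)
      simp only [Function.comp_apply, Prod.map, id, u.repr_apply_apply, inner_add_right,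
        real_inner_smul_right, inner_sub_right, inner_diagOp, totalFactor, hA, hρ]
      ring
    · intro i
      rw [Real.sq_sqrt (sampleVariance_nonneg _ _ _ _), mul_pow, hV,
        Real.sq_sqrt (sampleVariance_nonneg _ _ _ _), sampleVariance]
      ring

theorem continuous_diagOp_apply (z : Vec n) : Continuous fun f : Fin n → ℝ => diagOp u f z := by
  simp_rw [diagOp_apply]
  fun_prop

/-- The optimal denoisers built from one eigenbasis generate the truncated Gaussian. -/
theorem generates_of_optimal {S : ℝ → Vec n → Vec n} {m : Vec n} {lam : Fin n → ℝ} {K : ℕ}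
    (h0 : ∀ i, 0 ≤ lam i)
    (hS : ∀ σ : ℝ, 0 < σ → ∀ y, S σ y = m + act (optimalMap lam u K σ) (y - m))
    {η : ℝ} (hη : η ∈ Set.Icc (0 : ℝ) 1) :
    Generates S η (multivariateGaussian m (eigenTrunc lam u K)) := by
  intro s hs hstep f
  have ht0 (i : Fin n) : 0 ≤ truncSeq lam K i := by
    unfold truncSeq
    split_ifs
    exacts [h0 i, le_rfl]
  have hm (c : Vec n) (f : Fin n → ℝ) : Measurable fun z => c + diagOp u f z :=
    (measurable_diagOp f).const_add c
  set A : ℕ → Fin n → ℝ := fun k i =>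
    totalFactor (truncSeq lam K i) η (s k).level (s k).steps with hA
  set V : ℕ → Fin n → ℝ := fun k i =>
    √(sampleVariance (truncSeq lam K i) η (s k).level (s k).steps) with hV
  have hAlim : Tendsto A atTop (𝓝 0) :=
    tendsto_pi_nhds.2 fun i => tendsto_totalFactor (ht0 i) hs
  have hVlim : Tendsto V atTop (𝓝 fun i => √(truncSeq lam K i)) :=
    tendsto_pi_nhds.2 fun i => (tendsto_sampleVariance hη (ht0 i) hs hstep).sqrt
  have hlaw : ∀ᶠ k in atTop, ∫ z, f ((m - diagOp u (A k) m) + diagOp u (V k) z)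
      ∂(stdGaussian (Vec n)) = ∫ x, f x ∂(samplerLaw S η (s k).level (s k).steps) := by
    filter_upwards [hs.eventually_ge_atTop 0] with k hk
    rw [samplerLaw_eq h0 hS η (s k) hk le_rfl, integral_map (hm _ _).aemeasurable
      f.continuous.aestronglyMeasurable]
  refine Tendsto.congr' hlaw ?_
  rw [multivariateGaussian_eigenTrunc m h0, integral_map (hm _ _).aemeasurable
    f.continuous.aestronglyMeasurable]
  -- The measure is now fixed and only the affine map varies, so pointwise convergence and
  -- boundedness of `f` suffice.
  refine tendsto_integral_of_dominated_convergence (fun _ => ‖f‖)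
    (fun k => (f.continuous.measurable.comp (hm _ _)).aestronglyMeasurable) (integrable_const _)
    (fun k => Eventually.of_forall fun z => f.norm_coe_le_norm _)
    (Eventually.of_forall fun z => ?_)
  refine (f.continuous.tendsto _).comp (Tendsto.add ?_ ?_)
  · have h := ((continuous_diagOp_apply (u := u) m).tendsto 0).comp hAlim
    have hz : diagOp u 0 m = 0 := by simp [diagOp_apply]
    rw [hz] at h
    simpa using tendsto_const_nhds.sub h
  · exact ((continuous_diagOp_apply (u := u) z).tendsto _).comp hVlim

end Sampler

end BottleneckDiffusion

theorem theorem4 (n K : ℕ) (P : Measure (Vec n)) [IsProbabilityMeasure P] (hP : MemLp id 2 P)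
    (lam : Fin n → ℝ) (u : OrthonormalBasis (Fin n) ℝ (Vec n))
    (hu : IsSortedEigenbasis (covMat P) lam u) :
    -- the truncation is the best rank-`K` approximation of the covariance
    IsBestRankApprox K (covMat P) (eigenTrunc lam u K) ∧
    -- linear bottleneck, centred target: the optimal maps are the truncations `L*`
    (meanVec P = 0 → ∀ σ : ℝ, 0 < σ → ∀ S : Vec n → Vec n,
      (IsMSEOptimal P (LinearBottleneck n K) σ S ↔
        ∃ v : OrthonormalBasis (Fin n) ℝ (Vec n), IsSortedEigenbasis (covMat P) lam v ∧
          ∀ y, S y = act (optimalMap lam v K σ) y)) ∧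
    -- bottleneck with bias, arbitrary mean: the same maps around the mean
    (∀ σ : ℝ, 0 < σ → ∀ S : Vec n → Vec n,
      (IsMSEOptimal P (AffineBottleneck n K) σ S ↔
        ∃ v : OrthonormalBasis (Fin n) ℝ (Vec n), IsSortedEigenbasis (covMat P) lam v ∧
          ∀ y, S y = meanVec P + act (optimalMap lam v K σ) (y - meanVec P))) ∧
    -- without ties, `L*` is the only optimum, and every trained denoiser generates the Gaussian
    (HasSpectralGap lam K → meanVec P = 0 → ∀ S : ℝ → Vec n → Vec n,
      IsTrained P (LinearBottleneck n K) S →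
        (∀ σ : ℝ, 0 < σ → ∀ y, S σ y = act (optimalMap lam u K σ) y) ∧
        ∀ η ∈ Set.Icc (0 : ℝ) 1,
          Generates S η (multivariateGaussian (meanVec P) (eigenTrunc lam u K))) ∧
    (HasSpectralGap lam K → ∀ S : ℝ → Vec n → Vec n,
      IsTrained P (AffineBottleneck n K) S →
        (∀ σ : ℝ, 0 < σ → ∀ y,
          S σ y = meanVec P + act (optimalMap lam u K σ) (y - meanVec P)) ∧
        ∀ η ∈ Set.Icc (0 : ℝ) 1,
          Generates S η (multivariateGaussian (meanVec P) (eigenTrunc lam u K))) ∧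
    -- with or without ties, the denoisers `L*` built from one eigenbasis generate the Gaussian
    (∀ S : ℝ → Vec n → Vec n,
      (∀ σ : ℝ, 0 < σ → ∀ y,
        S σ y = meanVec P + act (optimalMap lam u K σ) (y - meanVec P)) →
        ∀ η ∈ Set.Icc (0 : ℝ) 1,
          Generates S η (multivariateGaussian (meanVec P) (eigenTrunc lam u K))) := by
  have h0 := eigenvalues_covMat_nonneg hP hu
  have hgen : ∀ S : ℝ → Vec n → Vec n,
      (∀ σ : ℝ, 0 < σ → ∀ y,
        S σ y = meanVec P + act (optimalMap lam u K σ) (y - meanVec P)) →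
        ∀ η ∈ Set.Icc (0 : ℝ) 1,
          Generates S η (multivariateGaussian (meanVec P) (eigenTrunc lam u K)) :=
    fun S hS η hη => generates_of_optimal h0 hS hη
  refine ⟨isBestRankApprox_eigenTrunc hu h0 K,
    fun hmean σ hσ S => isMSEOptimal_linearBottleneck_iff hP hu hmean hσ S,
    fun σ hσ S => isMSEOptimal_affineBottleneck_iff hP hu hσ S,
    fun hgap hmean S hS => ?_, fun hgap S hS => ?_, hgen⟩
  · have hSu : ∀ σ : ℝ, 0 < σ → ∀ y, S σ y = act (optimalMap lam u K σ) y := by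
      intro σ hσ y
      obtain ⟨v, hv, hSv⟩ := (isMSEOptimal_linearBottleneck_iff hP hu hmean hσ _).1 (hS σ hσ)
      rw [hSv, act_optimalMap_eq_of_hasSpectralGap hu hv hgap]
    refine ⟨hSu, hgen S fun σ hσ y => ?_⟩
    rw [hmean, zero_add, sub_zero, hSu σ hσ]
  · have hSu : ∀ σ : ℝ, 0 < σ → ∀ y,
        S σ y = meanVec P + act (optimalMap lam u K σ) (y - meanVec P) := by
      intro σ hσ y
      obtain ⟨v, hv, hSv⟩ := (isMSEOptimal_affineBottleneck_iff hP hu hσ _).1 (hS σ hσ)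
      rw [hSv, act_optimalMap_eq_of_hasSpectralGap hu hv hgap]
    exact ⟨hSu, hgen S hSu⟩
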